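/- \textbf{Definitions.} For an integer $n\ge 1$ let $\Sigma_n=\{1,2,\dots,n\}$; infinite words are one-sided. For a finite word $x$ let $x^R$ be its reversal. For rational $1<r\le 2$, an \emph{undirected $r$-power} is a finite word $xyx'$ with $x$ nonempty, $x'\in\{x,x^R\}$ and $|xyx'|/|xy|=r$. For real $1<\alpha\le 2$, a word is \emph{undirected $\alpha$-free} (respectively \emph{undirected $\alpha^+$-free}) if none of its factors is an undirected $r$-power with $r\ge\alpha$ (respectively $r>\alpha$). For $k\ge 2$, $\mathrm{URT}(k)$ is the infimum of all $1<\alpha\le 2$ such that some infinite word on $k$ letters is undirected $\alpha$-free ($\infty$ if there is no such $\alpha$). Let $k\ge 4$, and let $\boldsymbol w$ be an infinite word over $\Sigma_k$ that contains at least $k-1$ distinct letters, all of whose factors of length $k-2$ contain $k-2$ distinct letters, and all of whose factors of length $k$ contain at least $k-1$ distinct letters. Write $\boldsymbol w=u v_1v_2\cdots$, where $u$ is the shortest prefix of $\boldsymbol w$ containing $k-1$ distinct letters and the $v_i$ are letters. For $i\ge 0$ let $r_i[1],\dots,r_i[k]$ be the letters of $\Sigma_k$ listed in increasing order of the position of their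 last occurrence in $uv_1\cdots v_i$, a letter that does not occur there coming first. Then $v_i\in\{r_{i-1}[1],r_{i-1}[2],r_{i-1}[3]\}$ for all $i\ge 1$, and the \emph{encoding} of $\boldsymbol w$ is the infinite word $t_1t_2\cdots$ over $\Sigma_3$ with $v_i=r_{i-1}[t_i]$ for all $i\ge1$. Define morphisms $f_4,f_8,f_{12}:\Sigma_2^*\to\Sigma_2^*$ and $g:\Sigma_2^*\to\Sigma_3^*$ by \[ \begin{aligned} f_4(1)&=121, & f_4(2)&=122,\\ f_8(1)&=121212112122121, & f_8(2)&=211212122122112,\\ f_{12}(1)&=121212121211212122121, & f_{12}(2)&=212122112121121212212,\\ g(1)&=31, & g(2)&=312, \end{aligned} \] and let $f_k^\omega(1)$ be the infinite word that has $f_k^n(1)$ as a prefix for every $n\ge 0$. \textbf{Theorem.} Let $k\in\{4,8,12\}$. There is exactly one infinite word $\boldsymbol w$ over $\Sigma_k$ that has prefix $12\cdots(k-1)$ and encoding $g(f_k^\omega(1))$. This word is undirected $\left(\frac{k-1}{k-2}\right)^+$-free. Moreover, $\mathrm{URT}(k)=\frac{k-1}{k-2}$. -/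

import Mathlib

namespace UndirectedWords

/-! ### Words

Finite words over `A` are lists, infinite words over `A` are functions `ℕ → A`.
The letter `j` of the alphabet `{1, …, n}` is represented by the element `j - 1` of `Fin n`. -/

/-- The factor of length `n` of the infinite word `w` that starts at position `i`. -/
def factor {A : Type*} (w : ℕ → A) (i n : ℕ) : List A :=
  (List.range n).map fun j => w (i + j)

/-- The finite word `v` is a factor of the infinite word `w`. -/
def IsFactor {A : Type*} (v : List A) (w : ℕ → A) : Prop :=
  ∃ i n : ℕ, v = factor w i n

/-- Equality up to reversal. -/
def SameUpToReversal {A : Type*} (x x' : List A) : Prop :=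
  x' = x ∨ x' = x.reverse

/-- The word `v` is an undirected `r`-power: `v = x y x'` with `x` nonempty, `x'` equal to `x` or
to its reversal, and `|x y x'| / |x y| = r`. -/
def IsUndirectedPower {A : Type*} (r : ℚ) (v : List A) : Prop :=
  ∃ x y x' : List A, x ≠ [] ∧ SameUpToReversal x x' ∧ v = x ++ y ++ x' ∧
    ((x ++ y ++ x').length : ℚ) / ((x ++ y).length : ℚ) = r

/-- No factor of `w` is an undirected `r`-power with `r ≥ α`. -/
def UndirectedFree {A : Type*} (α : ℝ) (w : ℕ → A) : Prop :=
  ∀ v : List A, IsFactor v w → ∀ r : ℚ, α ≤ (r : ℝ) → ¬ IsUndirectedPower r v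

/-- No factor of `w` is an undirected `r`-power with `r > α`. -/
def UndirectedPlusFree {A : Type*} (α : ℝ) (w : ℕ → A) : Prop :=
  ∀ v : List A, IsFactor v w → ∀ r : ℚ, α < (r : ℝ) → ¬ IsUndirectedPower r v

/-- The undirected repetition threshold for `k` letters: the infimum of all `1 < α ≤ 2` for which
some infinite word on `k` letters is undirected `α`-free (`⊤` if there is no such `α`). -/
noncomputable def URT (k : ℕ) : EReal :=
  sInf ((fun α : ℝ => (α : EReal)) ''
    {α : ℝ | 1 < α ∧ α ≤ 2 ∧ ∃ w : ℕ → Fin k, UndirectedFree α w})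

/-! ### The ternary encoding -/

/-- `w` contains at least `k - 1` distinct letters, every factor of length `k - 2` contains `k - 2`
distinct letters, and every factor of length `k` contains at least `k - 1` distinct letters. -/
structure IsEncodable {k : ℕ} (w : ℕ → Fin k) : Prop where
  letters : ∃ n : ℕ, k - 1 ≤ (factor w 0 n).toFinset.card
  short_factors : ∀ i : ℕ, (factor w i (k - 2)).toFinset.card = k - 2
  long_factors : ∀ i : ℕ, k - 1 ≤ (factor w i k).toFinset.card

/-- One plus the last position at which the letter `a` occurs in the prefix of length `n` of `w`,
and `0` if `a` does not occur in that prefix. -/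
def lastOccurrence {k : ℕ} (w : ℕ → Fin k) (n : ℕ) (a : Fin k) : ℕ :=
  (Finset.range n).sup fun i => if w i = a then i + 1 else 0

/-- The permutation `r` ranks the letters by their last occurrence in the prefix of length `n` of
`w`: the last value of `r` is the letter that was read most recently, and a letter that does not
occur in the prefix comes first. -/
def IsRanking {k : ℕ} (w : ℕ → Fin k) (n : ℕ) (r : Equiv.Perm (Fin k)) : Prop :=
  StrictMono fun j => lastOccurrence w n (r j)

/-- The infinite ternary word `t` is the encoding of `w`. Here `m` is the length of the shortest
prefix of `w` that contains `k - 1` distinct letters, and the letter of `w` that follows the prefix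
of length `m + i` is the one in place `t i` of the ranking of the letters given by that prefix. -/
def IsEncoding {k : ℕ} (w : ℕ → Fin k) (t : ℕ → Fin 3) : Prop :=
  IsEncodable w ∧
    ∃ m : ℕ, IsLeast {n : ℕ | k - 1 ≤ (factor w 0 n).toFinset.card} m ∧
      ∀ i : ℕ, ∃ r : Equiv.Perm (Fin k), IsRanking w (m + i) r ∧
        ∃ j : Fin k, (j : ℕ) = (t i : ℕ) ∧ w (m + i) = r j

/-- The word `w` over `{1, …, k}` has prefix `12⋯(k-1)`. -/
def HasStandardPrefix {k : ℕ} (w : ℕ → Fin k) : Prop :=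
  ∀ i : ℕ, i < k - 1 → (w i : ℕ) = i

/-! ### Morphisms

A morphism is given by the images of the letters; its value at a finite word `v` is
`v.flatMap f`. -/

/-- The image of the infinite word `u` under the morphism `f` with nonempty images of letters:
its letter at position `i` is read off from the image of the prefix of length `i + 1` of `u`. -/
def mapWord {A B : Type*} [Inhabited B] (f : A → List B) (u : ℕ → A) (i : ℕ) : B :=
  ((factor u 0 (i + 1)).flatMap f).getD i default

/-- The finite word `f^n(a)`. -/
def iter {A : Type*} (f : A → List A) (a : A) (n : ℕ) : List A :=
  (fun v : List A => v.flatMap f)^[n] [a]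

/-- The infinite word `f^ω(a)`, for a morphism `f` with nonempty images of letters such that
`f(a)` begins with `a` and has length at least `2`: its letter at position `i` is that of
`f^(i+1)(a)`. -/
def omegaWord {A : Type*} (f : A → List A) (a : A) (i : ℕ) : A :=
  (iter f a (i + 1)).getD i a

/-- `f_4(1) = 121`, `f_4(2) = 122`. -/
def f4 : Fin 2 → List (Fin 2) :=
  ![[0, 1, 0],
    [0, 1, 1]]

/-- `f_8(1) = 121212112122121`, `f_8(2) = 211212122122112`. -/
def f8 : Fin 2 → List (Fin 2) :=
  ![[0, 1, 0, 1, 0, 1, 0, 0, 1, 0, 1, 1, 0, 1, 0],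
    [1, 0, 0, 1, 0, 1, 0, 1, 1, 0, 1, 1, 0, 0, 1]]

/-- `f_12(1) = 121212121211212122121`, `f_12(2) = 212122112121121212212`. -/
def f12 : Fin 2 → List (Fin 2) :=
  ![[0, 1, 0, 1, 0, 1, 0, 1, 0, 1, 0, 0, 1, 0, 1, 0, 1, 1, 0, 1, 0],
    [1, 0, 1, 0, 1, 1, 0, 0, 1, 0, 1, 0, 0, 1, 0, 1, 0, 1, 1, 0, 1]]

/-- `g(1) = 31`, `g(2) = 312`. -/
def g : Fin 2 → List (Fin 3) :=
  ![[2, 0],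
    [2, 0, 1]]

end UndirectedWords

/-! Write k = n + 4, let u be the fixed point of f, and let q be the length of f(1) and f(2). The
ranking after the prefix 12⋯(k-1) is known, and each code letter determines the next letter and the
next ranking; so decoding is forced, which gives uniqueness. For existence, every word encoded by an
image under `g` satisfies the conditions on distinct letters (`isEncodable_word`).

Freeness. In the word encoded by g(u), recurrences after k - 2 places mark the blocks 31 and 312
(`word_eq_iff`). Long equal or mutually reversed factors therefore have matching blocks and come
from equal or reversed factors of u (`exists_repetition`, `exists_reversal`). Reversed factors of u
are bounded in length, so reversed powers need only a finite search. A long direct repetition gives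
a repetition of u with equal rankings at its two occurrences. It can be pulled back through f:
occurrences of long factors are synchronized modulo q, and one permutation conjugates the action of
f(a) on places to that of a, so that equality of rankings survives (`RankedRepetition.descend`).
Being too long for its period is, up to bounded errors, a linear inequality between numbers of
blocks that survives the pull-back. This leads down to short repetitions, which are excluded by a
search in the words encoded by f^m(aa').

Threshold. In a (k-1)/(k-2)-free word any k - 1 consecutive letters are distinct. Excluding repeated
and reversed factors of length two forces every letter, from the second position on, to recur after
exactly k places, and this period again repeats a factor of length two (`not_undirectedFree`). -/

namespace UndirectedWords

/-! ### Decoding a ternary word -/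

/-- The permutation of the places of a ranking of `n + 4` letters that moves the letter in place
`j` to the last place. -/
def moveToEnd (n : ℕ) (j : Fin 3) : Equiv.Perm (Fin (n + 4)) where
  toFun p := if (p : ℕ) < j then p else
    if h : (p : ℕ) + 1 < n + 4 then ⟨p + 1, h⟩ else ⟨j, by omega⟩
  invFun p := if (p : ℕ) < j then p else
    if (p : ℕ) = j then ⟨n + 3, by omega⟩ else ⟨p - 1, by omega⟩
  left_inv p := by
    apply Fin.ext
    have := p.isLt
    have := j.isLt
    dsimp only
    split_ifs <;> dsimp only at * <;> omega
  right_inv p := by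
    apply Fin.ext
    have := p.isLt
    have := j.isLt
    rcases lt_trichotomy (p : ℕ) j with h | h | h
    · simp [h]
    · simp [h, show ¬ n + 3 < (j : ℕ) by omega]
    · have h1 : ¬ (p : ℕ) < j := by omega
      have h2 : (p : ℕ) ≠ j := by omega
      have h3 : ¬ (p : ℕ) - 1 < j := by omega
      have h4 : (p : ℕ) - 1 + 1 < n + 4 := by omega
      simp only [h1, h2, h3, h4, if_false, dif_pos]
      omega

theorem moveToEnd_val (n : ℕ) (j : Fin 3) (p : Fin (n + 4)) :
    (moveToEnd n j p : ℕ) = if (p : ℕ) < j then (p : ℕ) else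
      if (p : ℕ) + 1 < n + 4 then (p : ℕ) + 1 else j := by
  simp only [moveToEnd, Equiv.coe_fn_mk]
  split_ifs <;> rfl

/-- The ranking of the letters after the prefix `12⋯(k-1)` and the letters encoded by
`t 0, …, t (i - 1)`, where `k = n + 4`. -/
def ranking (n : ℕ) (t : ℕ → Fin 3) : ℕ → Equiv.Perm (Fin (n + 4))
  -- The unread letter `n + 3` comes first, then `0, …, n + 2` in the order of reading.
  | 0 => (finRotate (n + 4))⁻¹
  | i + 1 => ranking n t i * moveToEnd n (t i)

/-- The infinite word with standard prefix and encoding `t`. -/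
def decode (n : ℕ) (t : ℕ → Fin 3) (i : ℕ) : Fin (n + 4) :=
  if h : i < n + 3 then ⟨i, by omega⟩ else
    ranking n t (i - (n + 3)) ⟨t (i - (n + 3)), by omega⟩

theorem decode_of_lt {n : ℕ} (t : ℕ → Fin 3) {i : ℕ} (h : i < n + 3) :
    (decode n t i : ℕ) = i := by
  simp [decode, h]

theorem decode_add (n : ℕ) (t : ℕ → Fin 3) (i : ℕ) :
    decode n t (n + 3 + i) = ranking n t i ⟨t i, by omega⟩ := by
  simp [decode]

theorem ranking_zero_zero (n : ℕ) (t : ℕ → Fin 3) :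
    ranking n t 0 0 = Fin.last (n + 3) := by
  rw [ranking, Equiv.Perm.inv_eq_iff_eq, finRotate_last]

theorem ranking_zero_succ (n : ℕ) (t : ℕ → Fin 3) (p : ℕ) (h : p + 1 < n + 4) :
    ranking n t 0 ⟨p + 1, h⟩ = ⟨p, by omega⟩ := by
  rw [ranking, Equiv.Perm.inv_eq_iff_eq]
  rw [finRotate_of_lt (by omega)]

/-! ### Last occurrences -/

theorem lastOccurrence_le {k : ℕ} (w : ℕ → Fin k) (m : ℕ) (a : Fin k) :
    lastOccurrence w m a ≤ m := by
  apply Finset.sup_le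
  intro i hi
  have := Finset.mem_range.1 hi
  split_ifs <;> omega

theorem lastOccurrence_succ {k : ℕ} (w : ℕ → Fin k) (m : ℕ) (a : Fin k) :
    lastOccurrence w (m + 1) a = if w m = a then m + 1 else lastOccurrence w m a := by
  have h := lastOccurrence_le w m a
  have e : lastOccurrence w (m + 1) a = (if w m = a then m + 1 else 0) ⊔ lastOccurrence w m a := by
    rw [lastOccurrence, Finset.range_add_one, Finset.sup_insert]; rfl
  rw [e]
  split_ifs
  · exact sup_eq_left.2 (by omega)
  · simp

theorem lastOccurrence_congr {k : ℕ} {w w' : ℕ → Fin k} {m : ℕ} (h : ∀ i < m, w i = w' i) :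
    lastOccurrence w m = lastOccurrence w' m := by
  funext a
  apply Finset.sup_congr rfl
  intro i hi
  rw [h i (Finset.mem_range.1 hi)]

/-- Strictly monotone maps with the same range are equal, and a ranking makes last occurrences
injective on letters. -/
theorem IsRanking.unique {k : ℕ} {w : ℕ → Fin k} {m : ℕ} {r r' : Equiv.Perm (Fin k)}
    (h : IsRanking w m r) (h' : IsRanking w m r') : r = r' := by
  have e : (fun j => lastOccurrence w m (r j)) = fun j => lastOccurrence w m (r' j) := by
    apply (StrictMono.range_inj h h').1
    exact (r.surjective.range_comp (lastOccurrence w m)).trans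
      (r'.surjective.range_comp (lastOccurrence w m)).symm
  have inj : Function.Injective (lastOccurrence w m) := by
    intro a b hab
    obtain ⟨x, rfl⟩ := r.surjective a
    obtain ⟨y, rfl⟩ := r.surjective b
    rw [h.injective hab]
  exact Equiv.ext fun j => inj (congrFun e j)

theorem lastOccurrence_of_standard {n : ℕ} {w : ℕ → Fin (n + 4)} (hw : HasStandardPrefix w) :
    ∀ m ≤ n + 3, ∀ a : Fin (n + 4), lastOccurrence w m a = if (a : ℕ) < m then (a : ℕ) + 1 else 0 := by
  intro m
  induction m with
  | zero => intro _ a; simp [lastOccurrence]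
  | succ m ih =>
    intro hm a
    rw [lastOccurrence_succ, ih (by omega)]
    have := hw m (by omega)
    simp only [Fin.ext_iff, this]
    split_ifs <;> omega

theorem decode_standard (n : ℕ) (t : ℕ → Fin 3) : HasStandardPrefix (decode n t) := by
  intro i hi
  exact decode_of_lt t (by omega)

theorem isRanking_decode (n : ℕ) (t : ℕ → Fin 3) (i : ℕ) :
    IsRanking (decode n t) (n + 3 + i) (ranking n t i) := by
  induction i with
  | zero =>
    have key : ∀ p : Fin (n + 4), lastOccurrence (decode n t) (n + 3 + 0) (ranking n t 0 p) = p := by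
      intro p
      rw [lastOccurrence_of_standard (decode_standard n t) _ (by omega)]
      obtain ⟨p, hp⟩ := p
      cases p with
      | zero =>
        have := ranking_zero_zero n t
        rw [show (⟨0, hp⟩ : Fin (n + 4)) = 0 from rfl, this]
        simp
      | succ p =>
        rw [ranking_zero_succ]
        simp only
        split_ifs <;> omega
    intro p q hpq
    simp only [key]
    exact hpq
  | succ i ih =>
    intro p q hpq
    simp only [ranking, Equiv.Perm.coe_mul, Function.comp]
    rw [← add_assoc, lastOccurrence_succ, lastOccurrence_succ, decode_add]
    simp only [EmbeddingLike.apply_eq_iff_eq, Fin.ext_iff, moveToEnd_val]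
    have h0 := (t i).isLt
    have hl := lastOccurrence_le (decode n t) (n + 3 + i) (ranking n t i (moveToEnd n (t i) p))
    have hpq' : (p : ℕ) < q := hpq
    have hq := q.isLt
    have lt : ∀ a b : Fin (n + 4), (a : ℕ) < b →
        lastOccurrence (decode n t) (n + 3 + i) (ranking n t i a) <
        lastOccurrence (decode n t) (n + 3 + i) (ranking n t i b) := fun a b hab => ih hab
    split_ifs
    all_goals first
      | omega
      | apply lt
        simp only [moveToEnd_val]
        split_ifs
        all_goals omega

theorem card_factor_le {k : ℕ} (w : ℕ → Fin k) (i m : ℕ) : (factor w i m).toFinset.card ≤ m := by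
  refine (List.toFinset_card_le _).trans ?_
  simp [factor]

theorem length_factor {A : Type*} (w : ℕ → A) (i m : ℕ) : (factor w i m).length = m := by
  simp [factor]

theorem factor_add {A : Type*} (w : ℕ → A) (i m l : ℕ) :
    factor w i (m + l) = factor w i m ++ factor w (i + m) l := by
  simp [factor, List.range_add, Function.comp_def, add_assoc]

theorem isLeast_standard {n : ℕ} {w : ℕ → Fin (n + 4)} (hw : HasStandardPrefix w) :
    IsLeast {m : ℕ | n + 4 - 1 ≤ (factor w 0 m).toFinset.card} (n + 3) := by
  constructor
  · show n + 3 ≤ _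
    rw [List.toFinset_card_of_nodup, length_factor]
    rw [factor, List.nodup_map_iff_inj_on List.nodup_range]
    intro x hx y hy h
    have h1 := hw x (by simp at hx; omega)
    have h2 := hw y (by simp at hy; omega)
    simp only [zero_add] at h
    rw [h] at h1
    omega
  · intro m hm
    have := card_factor_le w 0 m
    have hm' : n + 3 ≤ (factor w 0 m).toFinset.card := hm
    omega

/-- Strong induction: the ranking at a position depends only on the earlier letters and is unique,
so the code letter forces the next letter. -/
theorem IsEncoding.eq_decode {n : ℕ} {w : ℕ → Fin (n + 4)} {t : ℕ → Fin 3}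
    (hw : HasStandardPrefix w) (h : IsEncoding w t) : w = decode n t := by
  obtain ⟨-, m, hm, h⟩ := h
  obtain rfl := hm.unique (isLeast_standard hw)
  funext i
  induction i using Nat.strong_induction_on with
  | _ i ih =>
    by_cases hi : i < n + 3
    · exact Fin.ext ((hw i (by omega)).trans (decode_of_lt t hi).symm)
    · obtain ⟨i, rfl⟩ := Nat.exists_eq_add_of_le (not_lt.1 hi)
      obtain ⟨r, hr, j, hj, e⟩ := h i
      have : r = ranking n t i := by
        refine IsRanking.unique (w := decode n t) (m := n + 3 + i) ?_ (isRanking_decode n t i)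
        unfold IsRanking at hr ⊢
        rwa [← lastOccurrence_congr ih]
      rw [e, this, decode_add]
      congr 1
      exact Fin.ext hj

theorem isEncoding_decode {n : ℕ} {t : ℕ → Fin 3} (h : IsEncodable (decode n t)) :
    IsEncoding (decode n t) t :=
  ⟨h, n + 3, isLeast_standard (decode_standard n t), fun i =>
    ⟨ranking n t i, isRanking_decode n t i, ⟨t i, by omega⟩, rfl, decode_add n t i⟩⟩

end UndirectedWords

/-! ### The word encoded by blocks, and the window of letters before each block -/

namespace UndirectedWords

/-! ### Images of infinite words -/

/-- The position in the image of `u` under the morphism `F` at which the image of the letter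
`u b` starts. -/
def imageStart {A B : Type*} (F : A → List B) (u : ℕ → A) (b : ℕ) : ℕ :=
  ((factor u 0 b).flatMap F).length

theorem imageStart_zero {A B : Type*} (F : A → List B) (u : ℕ → A) : imageStart F u 0 = 0 := by
  simp [imageStart, factor]

theorem factor_one {A : Type*} (u : ℕ → A) (i : ℕ) : factor u i 1 = [u i] := by
  simp [factor]

theorem imageStart_succ {A B : Type*} (F : A → List B) (u : ℕ → A) (b : ℕ) :
    imageStart F u (b + 1) = imageStart F u b + (F (u b)).length := by
  simp [imageStart, factor_add, factor_one]

theorem le_imageStart {A B : Type*} {F : A → List B} (hF : ∀ a, F a ≠ []) (u : ℕ → A) (b : ℕ) :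
    b ≤ imageStart F u b := by
  induction b with
  | zero => omega
  | succ b ih =>
    have := List.length_pos_iff.2 (hF (u b))
    rw [imageStart_succ]
    omega

theorem mapWord_imageStart {A B : Type*} [Inhabited B] {F : A → List B} (hF : ∀ a, F a ≠ [])
    (u : ℕ → A) (b j : ℕ) (hj : j < (F (u b)).length) :
    mapWord F u (imageStart F u b + j) = (F (u b))[j] := by
  have hb := le_imageStart hF u b
  -- The prefix of `u` read by `mapWord` splits into the letters before `b`, the letter `u b`, and a
  -- rest that does not matter.
  rw [mapWord, show imageStart F u b + j + 1 = b + (1 + (imageStart F u b + j - b)) by omega,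
    factor_add, factor_add, zero_add, factor_one, List.flatMap_append, List.flatMap_append,
    List.getD_append_right _ _ _ _ (by rw [← imageStart]; omega), ← imageStart,
    Nat.add_sub_cancel_left, List.getD_append _ _ _ _ (by simpa using hj)]
  simp [hj]

theorem exists_imageStart_le {A B : Type*} {F : A → List B} (hF : ∀ a, F a ≠ []) (u : ℕ → A)
    (i : ℕ) : ∃ b, imageStart F u b ≤ i ∧ i < imageStart F u (b + 1) := by
  induction i with
  | zero =>
    refine ⟨0, (imageStart_zero F u).le, ?_⟩
    have := le_imageStart hF u 1
    simp only [zero_add]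
    omega
  | succ i ih =>
    obtain ⟨b, h1, h2⟩ := ih
    by_cases h : i + 1 < imageStart F u (b + 1)
    · exact ⟨b, by omega, h⟩
    · have := List.length_pos_iff.2 (hF (u (b + 1)))
      exact ⟨b + 1, by omega, by rw [imageStart_succ]; omega⟩

/-! ### The blocks `31` and `312` -/

theorem eq_zero_or_one (a : Fin 2) : a = 0 ∨ a = 1 := by
  fin_cases a <;> simp

theorem g_ne_nil (a : Fin 2) : g a ≠ [] := by
  fin_cases a <;> simp [g]

/-- The position at which the `b`-th block starts. -/
abbrev blockStart (u : ℕ → Fin 2) (b : ℕ) : ℕ := imageStart g u b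

theorem length_g (a : Fin 2) : (g a).length = a + 2 := by
  fin_cases a <;> rfl

theorem blockStart_succ (u : ℕ → Fin 2) (b : ℕ) :
    blockStart u (b + 1) = blockStart u b + (u b + 2) := by
  rw [blockStart, imageStart_succ, length_g]

theorem strictMono_blockStart (u : ℕ → Fin 2) : StrictMono (blockStart u) :=
  strictMono_nat_of_lt_succ fun b => by
    have := blockStart_succ u b
    omega

theorem mapWord_g_zero (u : ℕ → Fin 2) (b : ℕ) : mapWord g u (blockStart u b) = 2 := by
  have := mapWord_imageStart g_ne_nil u b 0 (by rw [length_g]; omega)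
  rw [add_zero] at this
  rw [this]
  rcases eq_zero_or_one (u b) with h | h <;> simp [h, g]

theorem mapWord_g_one (u : ℕ → Fin 2) (b : ℕ) : mapWord g u (blockStart u b + 1) = 0 := by
  rw [mapWord_imageStart g_ne_nil u b 1 (by rw [length_g]; omega)]
  rcases eq_zero_or_one (u b) with h | h <;> simp [h, g]

theorem mapWord_g_two {u : ℕ → Fin 2} {b : ℕ} (h : u b = 1) :
    mapWord g u (blockStart u b + 2) = 1 := by
  rw [mapWord_imageStart g_ne_nil u b 2 (by rw [length_g, h]; decide)]
  simp only [h]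
  rfl

/-- The permutation of places effected by the block `g a`. -/
def blockPerm (n : ℕ) (a : Fin 2) : Equiv.Perm (Fin (n + 4)) :=
  ((g a).map (moveToEnd n)).prod

theorem blockPerm_zero (n : ℕ) : blockPerm n 0 = moveToEnd n 2 * moveToEnd n 0 := by
  simp [blockPerm, g]

theorem blockPerm_one (n : ℕ) :
    blockPerm n 1 = moveToEnd n 2 * moveToEnd n 0 * moveToEnd n 1 := by
  simp [blockPerm, g, mul_assoc]

/-- The ranking of the letters before the `b`-th block. -/
def blockRanking (n : ℕ) (u : ℕ → Fin 2) (b : ℕ) : Equiv.Perm (Fin (n + 4)) :=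
  ranking n (mapWord g u) (blockStart u b)

theorem blockRanking_succ (n : ℕ) (u : ℕ → Fin 2) (b : ℕ) :
    blockRanking n u (b + 1) = blockRanking n u b * blockPerm n (u b) := by
  rw [blockRanking, blockStart_succ]
  rcases eq_zero_or_one (u b) with h | h
  · rw [h, blockPerm_zero]
    simp only [Fin.val_zero, zero_add]
    rw [show blockStart u b + 2 = blockStart u b + 1 + 1 by omega, ranking, ranking,
      mapWord_g_one, mapWord_g_zero, mul_assoc, blockRanking]
  · rw [h, blockPerm_one]
    simp only [Fin.val_one]
    rw [show blockStart u b + (1 + 2) = blockStart u b + 1 + 1 + 1 by omega, ranking, ranking,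
      ranking, mapWord_g_one, mapWord_g_zero, mapWord_g_two h, blockRanking]
    simp only [mul_assoc]

/-- The infinite word encoded by `g u`. -/
def word (n : ℕ) (u : ℕ → Fin 2) : ℕ → Fin (n + 4) := decode n (mapWord g u)

theorem word_three (n : ℕ) (u : ℕ → Fin 2) (b : ℕ) :
    word n u (blockStart u b + (n + 3)) = blockRanking n u b ⟨2, by omega⟩ := by
  rw [word, add_comm (blockStart u b), decode_add, blockRanking]
  congr 1
  simp [mapWord_g_zero]

theorem word_one (n : ℕ) (u : ℕ → Fin 2) (b : ℕ) :
    word n u (blockStart u b + (n + 4)) = blockRanking n u b ⟨0, by omega⟩ := by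
  rw [word, show blockStart u b + (n + 4) = n + 3 + (blockStart u b + 1) by omega, decode_add,
    ranking, mapWord_g_zero, blockRanking, Equiv.Perm.mul_apply]
  congr 1
  simp [Fin.ext_iff, mapWord_g_one, moveToEnd_val]

theorem word_two (n : ℕ) {u : ℕ → Fin 2} {b : ℕ} (h : u b = 1) :
    word n u (blockStart u b + (n + 5)) = blockRanking n u b ⟨3, by omega⟩ := by
  rw [word, show blockStart u b + (n + 5) = n + 3 + (blockStart u b + 1 + 1) by omega, decode_add,
    ranking, ranking, mapWord_g_zero, mapWord_g_one, blockRanking, Equiv.Perm.mul_apply,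
    Equiv.Perm.mul_apply]
  congr 1
  simp [Fin.ext_iff, mapWord_g_two h, moveToEnd_val]

/-- The `n + 3` letters preceding those encoded by block `b` fill the places from 1 on, and place 0
is the one letter they miss. A block slides this window: old letters keep their order, and the new
ones come from places 2, 0 and, for 312, 3. -/
theorem word_blockStart_add (n : ℕ) (u : ℕ → Fin 2) (b : ℕ) :
    ∀ j (hj : j < n + 3), word n u (blockStart u b + j) = blockRanking n u b ⟨j + 1, by omega⟩ := by
  induction b with
  | zero =>
    intro j hj
    rw [blockRanking, blockStart, imageStart_zero, ranking_zero_succ]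
    exact Fin.ext (by simpa [word] using decode_of_lt (mapWord g u) hj)
  | succ b ih =>
    intro j hj
    have val : ∀ a : Fin 2, u b = a → ∀ (c : ℕ) (hc : c < n + 4),
        (blockPerm n a ⟨j + 1, by omega⟩ : ℕ) = c →
        blockRanking n u (b + 1) ⟨j + 1, by omega⟩ = blockRanking n u b ⟨c, hc⟩ := by
      intro a ha c hc e
      rw [blockRanking_succ, ha, Equiv.Perm.mul_apply]
      congr 1
      exact Fin.ext e
    rw [blockStart_succ]
    rcases eq_zero_or_one (u b) with h | h
    · have v := val 0 h
      rw [blockPerm_zero] at v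
      simp only [Equiv.Perm.mul_apply, moveToEnd_val] at v
      simp only [h, Fin.val_zero, zero_add]
      have v := fun c hc => v c hc
      rcases lt_trichotomy j (n + 1) with h1 | h1 | h1
      · rw [v (j + 3) (by omega) (by simp; split_ifs <;> omega),
          show blockStart u b + 2 + j = blockStart u b + (j + 2) by omega, ih _ (by omega)]
      · rw [v 2 (by omega) (by simp; split_ifs <;> omega), ← word_three]
        congr 1; omega
      · rw [v 0 (by omega) (by simp; split_ifs <;> omega), ← word_one]
        congr 1; omega
    · have v := val 1 h
      rw [blockPerm_one] at v
      simp only [Equiv.Perm.mul_apply, moveToEnd_val] at v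
      simp only [h, Fin.val_one]
      rcases lt_trichotomy j n with h1 | h1 | h1
      · rw [v (j + 4) (by omega) (by simp; split_ifs <;> omega),
          show blockStart u b + (1 + 2) + j = blockStart u b + (j + 3) by omega, ih _ (by omega)]
      · rw [v 2 (by omega) (by simp; split_ifs <;> omega), ← word_three]
        congr 1; omega
      · by_cases h2 : j = n + 1
        · rw [v 0 (by omega) (by simp; split_ifs <;> omega), ← word_one]
          congr 1; omega
        · rw [v 3 (by omega) (by simp; split_ifs <;> omega), ← word_two n h]
          congr 1; omega

end UndirectedWords

/-! ### Transfer of repetitions between the encoded word and `u` -/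

namespace UndirectedWords

/-! ### Positions of repeated letters -/

theorem blockStart_add_two_le (u : ℕ → Fin 2) (b : ℕ) :
    blockStart u b + 2 ≤ blockStart u (b + 1) ∧ blockStart u (b + 1) ≤ blockStart u b + 3 := by
  have := blockStart_succ u b
  omega

/-- Every position is `0`, `1` or `2` places after the start of its block. -/
theorem exists_blockStart (u : ℕ → Fin 2) (i : ℕ) :
    ∃ b, i = blockStart u b ∨ i = blockStart u b + 1 ∨ (i = blockStart u b + 2 ∧ u b = 1) := by
  obtain ⟨b, h1, h2⟩ := exists_imageStart_le g_ne_nil u i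
  refine ⟨b, ?_⟩
  have h3 := blockStart_succ u b
  have h4 : u b = 1 ↔ (u b : ℕ) = 1 := by rw [Fin.ext_iff]; rfl
  rw [h4]
  have : imageStart g u b = blockStart u b := rfl
  have : imageStart g u (b + 1) = blockStart u (b + 1) := rfl
  omega

theorem word_ne_of_lt (n : ℕ) (u : ℕ → Fin 2) (b : ℕ) {x y : ℕ} (hxy : x < y)
    (hy : y < n + 3) : word n u (blockStart u b + x) ≠ word n u (blockStart u b + y) := by
  rw [word_blockStart_add n u b x (by omega), word_blockStart_add n u b y hy]
  simp [Fin.ext_iff]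
  omega

/-- The code letters 31 append first the letter at offset 1, then the letter missing from the
window; so the letters from offset 2 on stay distinct for two more places. -/
theorem word_ne_of_two_le (n : ℕ) (u : ℕ → Fin 2) (b : ℕ) {x y : ℕ} (hx : 2 ≤ x) (hxy : x < y)
    (hy : y < n + 5) : word n u (blockStart u b + x) ≠ word n u (blockStart u b + y) := by
  by_cases h : y < n + 3
  · exact word_ne_of_lt n u b hxy h
  · by_cases h1 : y = n + 3
    · rw [h1, word_three, word_blockStart_add n u b x (by omega)]
      simp [Fin.ext_iff]
      omega
    · rw [show y = n + 4 by omega, word_one]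
      by_cases h2 : x = n + 3
      · rw [h2, word_three]
        simp [Fin.ext_iff]
      · rw [word_blockStart_add n u b x (by omega)]
        simp [Fin.ext_iff]

theorem word_ne (n : ℕ) (u : ℕ → Fin 2) {i j : ℕ} (hij : i < j) (hj : j < i + (n + 2)) :
    word n u i ≠ word n u j := by
  obtain ⟨b, h⟩ := exists_blockStart u i
  obtain ⟨d, rfl⟩ := Nat.exists_eq_add_of_lt hij
  rcases h with h | h | ⟨h, -⟩
  · have := word_ne_of_lt n u b (x := 0) (y := d + 1) (by omega) (by omega)
    rwa [add_zero, ← h, ← add_assoc] at this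
  · have := word_ne_of_lt n u b (x := 1) (y := 1 + d + 1) (by omega) (by omega)
    rwa [← h, ← add_assoc, ← add_assoc, ← h] at this
  · have := word_ne_of_two_le n u b (x := 2) (y := 2 + d + 1) (by omega) (by omega) (by omega)
    rwa [← h, ← add_assoc, ← add_assoc, ← h] at this

/-- The letter at position `i` recurs after `n + 2` places if and only if `i` is the second
position of a block. -/
theorem word_eq_iff (n : ℕ) (u : ℕ → Fin 2) (i : ℕ) :
    word n u i = word n u (i + (n + 2)) ↔ ∃ b, i = blockStart u b + 1 := by
  constructor
  · intro e
    obtain ⟨b, h⟩ := exists_blockStart u i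
    rcases h with h | h | ⟨h, -⟩
    · rw [h] at e
      exact absurd e (word_ne_of_lt n u b (x := 0) (y := n + 2) (by omega) (by omega))
    · exact ⟨b, h⟩
    · rw [h, add_assoc] at e
      exact absurd e (word_ne_of_two_le n u b (by omega) (by omega) (by omega))
  · rintro ⟨b, rfl⟩
    rw [show blockStart u b + 1 + (n + 2) = blockStart u b + (n + 3) by omega, word_three,
      word_blockStart_add n u b 1 (by omega)]

theorem card_factor_of_injOn {k : ℕ} {w : ℕ → Fin k} {i m : ℕ}
    (h : ∀ x y, x < y → y < m → w (i + x) ≠ w (i + y)) : (factor w i m).toFinset.card = m := by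
  rw [List.toFinset_card_of_nodup, length_factor]
  rw [factor, List.nodup_map_iff_inj_on List.nodup_range]
  intro x hx y hy e
  rw [List.mem_range] at hx hy
  rcases lt_trichotomy x y with hxy | hxy | hxy
  · exact absurd e (h x y hxy hy)
  · exact hxy
  · exact absurd e.symm (h y x hxy hx)

theorem isEncodable_word (n : ℕ) (u : ℕ → Fin 2) : IsEncodable (word n u) where
  letters := ⟨n + 3, (isLeast_standard (decode_standard n _)).1⟩
  short_factors i := by
    refine card_factor_of_injOn fun x y hxy hy => word_ne n u (by omega) (by omega)
  long_factors i := by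
    show n + 3 ≤ _
    obtain ⟨b, h⟩ := exists_blockStart u i
    have mono : ∀ l m r, factor (word n u) i (n + 4) = l ++ m ++ r →
        m.toFinset.card = n + 3 → n + 3 ≤ (factor (word n u) i (n + 4)).toFinset.card := by
      intro l m r e hm
      rw [e, ← hm]
      apply Finset.card_le_card
      intro a
      simp
      tauto
    rcases h with h | h | ⟨h, -⟩
    · refine mono [] (factor (word n u) i (n + 3)) _ (factor_add _ i (n + 3) 1) ?_
      refine card_factor_of_injOn fun x y hxy hy => ?_
      rw [h]
      exact word_ne_of_lt n u b hxy hy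
    -- The letter at the second position of a block recurs after `n + 2` places, so it is dropped.
    · refine mono (factor (word n u) i 1) (factor (word n u) (i + 1) (n + 3)) [] ?_ ?_
      · rw [List.append_nil, ← factor_add]
        congr 1
        omega
      · refine card_factor_of_injOn fun x y hxy hy => ?_
        rw [h, add_assoc, add_assoc, add_assoc, add_assoc]
        exact word_ne_of_two_le n u b (by omega) (by omega) (by omega)
    · refine mono [] (factor (word n u) i (n + 3)) _ (factor_add _ i (n + 3) 1) ?_
      refine card_factor_of_injOn fun x y hxy hy => ?_
      rw [h, add_assoc, add_assoc]
      exact word_ne_of_two_le n u b (by omega) (by omega) (by omega)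

/-! ### Equal factors of `u` -/

theorem blockRanking_add_eq {n : ℕ} {u u' : ℕ → Fin 2} {b b' N : ℕ}
    (h : ∀ j < N, u (b + j) = u' (b' + j)) {π : Equiv.Perm (Fin (n + 4))}
    (hπ : blockRanking n u b = π * blockRanking n u' b') :
    ∀ j ≤ N, blockRanking n u (b + j) = π * blockRanking n u' (b' + j) := by
  intro j
  induction j with
  | zero => exact fun _ => hπ
  | succ j ih =>
    intro hj
    rw [← add_assoc, ← add_assoc, blockRanking_succ, blockRanking_succ, ih (by omega),
      h j (by omega), mul_assoc]

theorem blockStart_add_eq {u u' : ℕ → Fin 2} {b b' N : ℕ}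
    (h : ∀ j < N, u (b + j) = u' (b' + j)) :
    ∀ j ≤ N, blockStart u (b + j) + blockStart u' b' = blockStart u b + blockStart u' (b' + j) := by
  intro j
  induction j with
  | zero => exact fun _ => rfl
  | succ j ih =>
    intro hj
    rw [← add_assoc, ← add_assoc, blockStart_succ, blockStart_succ, h j (by omega)]
    have := ih (by omega)
    omega

/-- The words encoded by equal factors of `u` and `u'` are equal up to a permutation of letters. -/
theorem word_eq_of_ranking {n : ℕ} {u u' : ℕ → Fin 2} {b b' N : ℕ}
    (h : ∀ j < N, u (b + j) = u' (b' + j)) {π : Equiv.Perm (Fin (n + 4))}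
    (hπ : blockRanking n u b = π * blockRanking n u' b') :
    ∀ j, blockStart u b + j < blockStart u (b + N) + (n + 3) →
      word n u (blockStart u b + j) = π (word n u' (blockStart u' b' + j)) := by
  induction N with
  | zero =>
    intro j hj
    rw [word_blockStart_add n u b j (by simpa using hj),
      word_blockStart_add n u' b' j (by simpa using hj), hπ, Equiv.Perm.mul_apply]
  | succ N ih =>
    intro j hj
    by_cases hj' : blockStart u b + j < blockStart u (b + N) + (n + 3)
    · exact ih (fun j hj => h j (by omega)) j hj'
    · have hQ := blockRanking_add_eq h hπ N (by omega)
      have hS := blockStart_add_eq h N (by omega)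
      have hs := blockStart_succ u (b + N)
      have hu := h N (by omega)
      rw [show b + (N + 1) = b + N + 1 from rfl, hs] at hj
      obtain ⟨d, hd⟩ := Nat.exists_eq_add_of_le (not_lt.1 hj')
      have hd' : blockStart u' b' + j = blockStart u' (b' + N) + (n + 3) + d := by omega
      rw [hd, hd']
      have : d = 0 ∨ d = 1 ∨ (d = 2 ∧ u (b + N) = 1) := by
        have h4 : u (b + N) = 1 ↔ (u (b + N) : ℕ) = 1 := by rw [Fin.ext_iff]; rfl
        omega
      rcases this with rfl | rfl | ⟨rfl, h1⟩
      · rw [add_zero, add_zero, word_three, word_three, hQ, Equiv.Perm.mul_apply]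
      · rw [add_assoc _ (n + 3) 1, add_assoc (blockStart u' _) (n + 3) 1, word_one, word_one, hQ, Equiv.Perm.mul_apply]
      · rw [add_assoc _ (n + 3) 2, add_assoc (blockStart u' _) (n + 3) 2, word_two n h1, word_two n (hu ▸ h1), hQ, Equiv.Perm.mul_apply]

theorem exists_perm_word {u u' : ℕ → Fin 2} {b b' N : ℕ} (n : ℕ)
    (h : ∀ j < N, u (b + j) = u' (b' + j)) :
    ∃ π : Equiv.Perm (Fin (n + 4)), ∀ j, blockStart u b + j < blockStart u (b + N) + (n + 3) →
      word n u (blockStart u b + j) = π (word n u' (blockStart u' b' + j)) :=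
  ⟨blockRanking n u b * (blockRanking n u' b')⁻¹, word_eq_of_ranking h (by simp)⟩

/-- The window shows all places but place 0, and a permutation is determined by all of its values
but one. -/
theorem blockRanking_eq_of_word {n : ℕ} {u : ℕ → Fin 2} {b c : ℕ}
    (h : ∀ j < n + 3, word n u (blockStart u b + j) = word n u (blockStart u c + j)) :
    blockRanking n u b = blockRanking n u c := by
  have h' : ∀ p : Fin (n + 4), p ≠ 0 → blockRanking n u b p = blockRanking n u c p := by
    rintro ⟨p, hp⟩ h0
    cases p with
    | zero => exact absurd rfl h0
    | succ p =>
      have := h p (by omega)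
      rwa [word_blockStart_add n u b p (by omega), word_blockStart_add n u c p (by omega)] at this
  apply Equiv.ext
  intro p
  by_cases h0 : p = 0
  · subst h0
    obtain ⟨q, hq⟩ := (blockRanking n u c).surjective (blockRanking n u b 0)
    by_cases hq0 : q = 0
    · rw [← hq, hq0]
    · rw [← h' q hq0] at hq
      exact absurd ((blockRanking n u b).injective hq) hq0
  · exact h' p h0

/-! ### Repetitions in the word and in `u` -/

theorem exists_blockStart_ge (u : ℕ → Fin 2) (i : ℕ) :
    ∃ b, i ≤ blockStart u b ∧ blockStart u b ≤ i + 2 := by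
  obtain ⟨b, h⟩ := exists_blockStart u i
  have := blockStart_add_two_le u b
  rcases h with h | h | ⟨h, -⟩
  · exact ⟨b, by omega⟩
  · exact ⟨b + 1, by omega⟩
  · exact ⟨b + 1, by omega⟩

/-- `word_eq_iff` recognizes a block start `s` from the letters at `s + 1` and `s + (n + 3)`. As
long as both lie in the repeated factor, block starts are carried to block starts, and the distances
between them give the letters of `u`. -/
theorem exists_repetition {n : ℕ} {u : ℕ → Fin 2} {i p l b : ℕ}
    (h : ∀ j < l, word n u (i + j) = word n u (i + p + j)) (hb : i ≤ blockStart u b) (N : ℕ)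
    (hN : blockStart u (b + N) + (n + 3) < i + l) :
    ∃ c, (∀ m ≤ N, blockStart u (c + m) = blockStart u (b + m) + p) ∧
      ∀ m < N, u (b + m) = u (c + m) := by
  have hE : ∀ x, i ≤ x → x + (n + 2) < i + l →
      ((∃ b, x = blockStart u b + 1) ↔ ∃ b, x + p = blockStart u b + 1) := by
    intro x hx hx'
    rw [← word_eq_iff n, ← word_eq_iff n]
    obtain ⟨j, rfl⟩ := Nat.exists_eq_add_of_le hx
    have h1 := h j (by omega)
    have h2 := h (j + (n + 2)) (by omega)
    rw [h1, add_assoc i j, h2]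
    ring_nf
  have mono := strictMono_blockStart u
  induction N with
  | zero =>
    obtain ⟨c, hc⟩ := (hE (blockStart u b + 1) (by omega) (by simp at hN; omega)).1 ⟨b, rfl⟩
    refine ⟨c, fun m hm => ?_, fun m hm => by omega⟩
    obtain rfl : m = 0 := by omega
    simp only [add_zero]
    omega
  | succ N ih =>
    have hlt : blockStart u (b + N) < blockStart u (b + (N + 1)) := mono (by omega)
    have hle : blockStart u b ≤ blockStart u (b + N) := mono.monotone (by omega)
    obtain ⟨c, h1, h2⟩ := ih (by omega)
    have hcN := h1 N le_rfl
    obtain ⟨d, hd⟩ := (hE (blockStart u (b + (N + 1)) + 1) (by omega) (by omega)).1 ⟨_, rfl⟩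
    have hcd : c + N < d := mono.lt_iff_lt.1 (by omega)
    have hd' : blockStart u (c + (N + 1)) ≤ blockStart u d := mono.monotone (by omega)
    have hcc : blockStart u (c + N) < blockStart u (c + (N + 1)) := mono (by omega)
    have key : blockStart u (c + (N + 1)) = blockStart u (b + (N + 1)) + p := by
      -- An additional block start in the second occurrence would be carried back to one strictly
      -- between two consecutive block starts.
      by_contra hne
      obtain ⟨e, he⟩ := (hE (blockStart u (c + (N + 1)) + 1 - p) (by omega) (by omega)).2
        ⟨c + (N + 1), by omega⟩
      have h3 : b + N < e := mono.lt_iff_lt.1 (by omega)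
      have h4 : e < b + (N + 1) := mono.lt_iff_lt.1 (by omega)
      omega
    refine ⟨c, fun m hm => ?_, fun m hm => ?_⟩
    · rcases Nat.lt_or_ge N m with h | h
      · obtain rfl : m = N + 1 := by omega
        exact key
      · exact h1 m h
    · rcases Nat.lt_or_ge m N with h | h
      · exact h2 m h
      · obtain rfl : m = N := by omega
        have e1 := blockStart_succ u (b + m)
        have e2 := blockStart_succ u (c + m)
        rw [← add_assoc, ← add_assoc] at key
        exact Fin.ext (by omega)

/-- As in `exists_repetition`, but the reflection `x ↦ e + i - x` swaps the ends of a recurring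
pair. The pair starting at `x` goes to the one starting at `e + i - (n + 2) - x`, and the blocks run
backwards. -/
theorem exists_reversal {n : ℕ} {u : ℕ → Fin 2} {i e l b : ℕ} (hle : l ≤ e + 1)
    (h : ∀ j < l, word n u (i + j) = word n u (e - j)) (hb : i ≤ blockStart u b) (N : ℕ)
    (hN : blockStart u (b + N) + (n + 3) < i + l) :
    ∃ c, N ≤ c ∧ (∀ m ≤ N, blockStart u (c - m) + blockStart u (b + m) + (n + 4) = e + i) ∧
      ∀ m < N, u (b + m) = u (c - 1 - m) := by
  have hE : ∀ x, i ≤ x → x + (n + 2) < i + l →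
      ((∃ b, x = blockStart u b + 1) ↔ ∃ b, e + i - (n + 2) - x = blockStart u b + 1) := by
    intro x hx hx'
    rw [← word_eq_iff n, ← word_eq_iff n]
    obtain ⟨j, rfl⟩ := Nat.exists_eq_add_of_le hx
    have h1 := h j (by omega)
    have h2 := h (j + (n + 2)) (by omega)
    rw [h1, add_assoc i j, h2, show e + i - (n + 2) - (i + j) = e - (j + (n + 2)) by omega,
      show e - (j + (n + 2)) + (n + 2) = e - j by omega]
    exact eq_comm
  have mono := strictMono_blockStart u
  induction N with
  | zero =>
    obtain ⟨c, hc⟩ := (hE (blockStart u b + 1) (by omega) (by simp at hN; omega)).1 ⟨b, rfl⟩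
    refine ⟨c, by omega, fun m hm => ?_, fun m hm => by omega⟩
    obtain rfl : m = 0 := by omega
    simp only [add_zero, Nat.sub_zero]
    omega
  | succ N ih =>
    have hlt : blockStart u (b + N) < blockStart u (b + (N + 1)) := mono (by omega)
    have hle : blockStart u b ≤ blockStart u (b + N) := mono.monotone (by omega)
    obtain ⟨c, h0, h1, h2⟩ := ih (by omega)
    have hcN := h1 N le_rfl
    obtain ⟨d, hd⟩ := (hE (blockStart u (b + (N + 1)) + 1) (by omega) (by omega)).1 ⟨_, rfl⟩
    have hcd : d < c - N := mono.lt_iff_lt.1 (by omega)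
    have hd' : blockStart u d ≤ blockStart u (c - (N + 1)) := mono.monotone (by omega)
    have hcc : blockStart u (c - (N + 1)) < blockStart u (c - N) := mono (by omega)
    have key : blockStart u (c - (N + 1)) + blockStart u (b + (N + 1)) + (n + 4) = e + i := by
      by_contra hne
      obtain ⟨f, hf⟩ := (hE (e + i - (n + 2) - (blockStart u (c - (N + 1)) + 1)) (by omega)
        (by omega)).2 ⟨c - (N + 1), by omega⟩
      have h3 : b + N < f := mono.lt_iff_lt.1 (by omega)
      have h4 : f < b + (N + 1) := mono.lt_iff_lt.1 (by omega)
      omega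
    refine ⟨c, by omega, fun m hm => ?_, fun m hm => ?_⟩
    · rcases Nat.lt_or_ge N m with h | h
      · obtain rfl : m = N + 1 := by omega
        exact key
      · exact h1 m h
    · rcases Nat.lt_or_ge m N with h | h
      · exact h2 m h
      · obtain rfl : m = N := by omega
        have e1 := blockStart_succ u (b + m)
        have e2 := blockStart_succ u (c - (m + 1))
        rw [show c - (m + 1) + 1 = c - m by omega] at e2
        rw [show b + (m + 1) = b + m + 1 from rfl] at key
        rw [show c - 1 - m = c - (m + 1) by omega]
        exact Fin.ext (by omega)

end UndirectedWords

/-! ### Self-similarity of the fixed point and proportionality of lengths -/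

namespace UndirectedWords

/-! ### Fixed points of uniform morphisms -/

/-- The infinite word `u` is the image of itself under the morphism `f`, whose images of letters
have length `q`. -/
structure IsUniformFixedPoint (f : Fin 2 → List (Fin 2)) (q : ℕ) (u : ℕ → Fin 2) : Prop where
  length : ∀ a, (f a).length = q
  apply : ∀ c r, r < q → u (q * c + r) = (f (u c)).getD r 0

theorem length_flatMap_of_uniform {f : Fin 2 → List (Fin 2)} {q : ℕ} (hf : ∀ a, (f a).length = q)
    (v : List (Fin 2)) : (v.flatMap f).length = q * v.length := by
  induction v with
  | nil => simp
  | cons a v ih => simp [ih, hf]; ring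

theorem getD_flatMap_of_uniform {f : Fin 2 → List (Fin 2)} {q : ℕ} (hf : ∀ a, (f a).length = q)
    (v : List (Fin 2)) (c r : ℕ) (hc : c < v.length) (hr : r < q) :
    (v.flatMap f).getD (q * c + r) 0 = (f (v.getD c 0)).getD r 0 := by
  induction v generalizing c with
  | nil => simp at hc
  | cons a v ih =>
    rw [List.flatMap_cons]
    cases c with
    | zero =>
      rw [List.getD_append _ _ _ _ (by rw [hf]; omega)]
      simp
    | succ c =>
      rw [List.getD_append_right _ _ _ _ (by rw [hf]; nlinarith), hf,
        show q * (c + 1) + r - q = q * c + r by rw [mul_add]; omega, ih c (by simpa using hc),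
        List.getD_cons_succ]

theorem iter_zero (f : Fin 2 → List (Fin 2)) (a : Fin 2) : iter f a 0 = [a] := rfl

theorem iter_succ (f : Fin 2 → List (Fin 2)) (a : Fin 2) (m : ℕ) :
    iter f a (m + 1) = (iter f a m).flatMap f := by
  rw [iter, Function.iterate_succ_apply', iter]

theorem length_iter {f : Fin 2 → List (Fin 2)} {q : ℕ} (hf : ∀ a, (f a).length = q) (a : Fin 2)
    (m : ℕ) : (iter f a m).length = q ^ m := by
  induction m with
  | zero => rfl
  | succ m ih => rw [iter_succ, length_flatMap_of_uniform hf, ih, pow_succ, mul_comm]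

theorem iter_prefix {f : Fin 2 → List (Fin 2)} {a : Fin 2} (h0 : [a] <+: f a) (m : ℕ) :
    iter f a m <+: iter f a (m + 1) := by
  induction m with
  | zero => rw [iter_succ, iter_zero]; simpa using h0
  | succ m ih =>
    rw [iter_succ, iter_succ f a (m + 1)]
    obtain ⟨t, ht⟩ := ih
    exact ⟨t.flatMap f, by rw [← List.flatMap_append, ht]⟩

theorem getD_iter_of_le {f : Fin 2 → List (Fin 2)} {q : ℕ} (hf : ∀ a, (f a).length = q)
    {a : Fin 2} (h0 : [a] <+: f a) {m m' : ℕ} (hm : m ≤ m') {i : ℕ} (hi : i < q ^ m) :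
    (iter f a m').getD i a = (iter f a m).getD i a := by
  have hp : iter f a m <+: iter f a m' := by
    induction m', hm using Nat.le_induction with
    | base => exact List.prefix_rfl
    | succ m' _ ih => exact ih.trans (iter_prefix h0 m')
  obtain ⟨t, ht⟩ := hp
  rw [← ht, List.getD_append _ _ _ _ (by rwa [length_iter hf])]

/-- The iterates are prefixes of one another, so a letter can be read off any iterate that is long
enough. -/
theorem isUniformFixedPoint_omegaWord {f : Fin 2 → List (Fin 2)} {q : ℕ} (hq : 1 < q)
    (hf : ∀ a, (f a).length = q) (h0 : [0] <+: f 0) :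
    IsUniformFixedPoint f q (omegaWord f 0) := by
  have value : ∀ i m, i < q ^ m → omegaWord f 0 i = (iter f 0 m).getD i 0 := by
    intro i m hi
    rw [omegaWord]
    rcases le_total m (i + 1) with h | h
    · exact getD_iter_of_le hf h0 h hi
    · refine (getD_iter_of_le hf h0 h ?_).symm
      exact (Nat.lt_succ_self i).trans (Nat.lt_pow_self hq)
  refine ⟨hf, fun c r hr => ?_⟩
  have hc : c < q ^ c := Nat.lt_pow_self hq
  rw [value c c hc, value (q * c + r) (c + 1) (by rw [pow_succ]; nlinarith), iter_succ,
    getD_flatMap_of_uniform hf _ _ _ (by rwa [length_iter hf]) hr]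

theorem IsUniformFixedPoint.iterate {f : Fin 2 → List (Fin 2)} {q : ℕ} {u : ℕ → Fin 2}
    (h : IsUniformFixedPoint f q u) (m : ℕ) :
    IsUniformFixedPoint (fun a => iter f a m) (q ^ m) u := by
  refine ⟨fun a => length_iter h.length a m, ?_⟩
  induction m with
  | zero =>
    intro c r hr
    obtain rfl : r = 0 := by simpa using hr
    simp [iter_zero]
  | succ m ih =>
    intro c r hr
    have hq : 0 < q := by
      rcases Nat.eq_zero_or_pos q with rfl | hq
      · simp at hr
      · exact hq
    have hr1 : r / q < q ^ m := Nat.div_lt_of_lt_mul (by rwa [← pow_succ'])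
    have hr2 := Nat.mod_lt r hq
    have e : q ^ (m + 1) * c + r = q * (q ^ m * c + r / q) + r % q := by
      conv_lhs => rw [← Nat.div_add_mod r q]
      ring
    rw [e, h.apply _ _ hr2, ih _ _ hr1, iter_succ]
    conv_rhs => rw [← Nat.div_add_mod r q]
    rw [getD_flatMap_of_uniform h.length _ _ _ (by rwa [length_iter h.length]) hr2]

/-- The infinite word `v000⋯`, in the alphabet `{0, 1}`. -/
def pad (v : List (Fin 2)) (i : ℕ) : Fin 2 := v.getD i 0

theorem IsUniformFixedPoint.exists_pair {f : Fin 2 → List (Fin 2)} {q : ℕ} {u : ℕ → Fin 2}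
    (h : IsUniformFixedPoint f q u) (hq : 0 < q) (b : ℕ) :
    ∃ a a' : Fin 2, ∀ j < q + 1, u (b + j) = pad (f a ++ f a') (b % q + j) := by
  refine ⟨u (b / q), u (b / q + 1), fun j hj => ?_⟩
  have hb := Nat.div_add_mod b q
  have hm := Nat.mod_lt b hq
  rw [pad]
  by_cases hj' : b % q + j < q
  · rw [List.getD_append _ _ _ _ (by rwa [h.length]), ← h.apply _ _ hj']
    congr 1
    omega
  · rw [List.getD_append_right _ _ _ _ (by rw [h.length]; omega), h.length,
      ← h.apply _ _ (by omega)]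
    congr 1
    rw [mul_add]
    omega

/-! ### Lengths of factors -/

/-- The length of the image of `v` under `g`. -/
def gLength (v : List (Fin 2)) : ℕ := (v.map fun a => (a : ℕ) + 2).sum

theorem blockStart_add_factor (u : ℕ → Fin 2) (b d : ℕ) :
    blockStart u (b + d) = blockStart u b + gLength (factor u b d) := by
  induction d with
  | zero => simp [gLength, factor]
  | succ d ih =>
    rw [← add_assoc, blockStart_succ, ih, factor_add, factor_one]
    simp [gLength]
    omega

theorem IsUniformFixedPoint.factor_eq_take {f : Fin 2 → List (Fin 2)} {q : ℕ} {u : ℕ → Fin 2}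
    (h : IsUniformFixedPoint f q u) (c : ℕ) {r : ℕ} (hr : r ≤ q) :
    factor u (q * c) r = (f (u c)).take r := by
  apply List.ext_getElem
  · simp [length_factor, h.length, hr]
  · intro i h1 h2
    rw [length_factor] at h1
    simp only [factor, List.getElem_map, List.getElem_range, List.getElem_take]
    rw [h.apply c i (by omega), List.getD_eq_getElem _ _ (by rw [h.length]; omega)]

/-- A sequence that is the sum of a monotone sequence of the block numbers and of a bounded
sequence is almost monotone. -/
theorem sub_le_of_monotone_add {q : ℕ} {e : ℕ → ℤ} {H : ℕ → ℤ} {lo hi : ℤ}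
    (hH : Monotone H) (he : ∀ x, lo ≤ e x - H (x / q) ∧ e x - H (x / q) ≤ hi) {x y : ℕ}
    (hxy : x ≤ y) : e x - e y ≤ hi - lo := by
  have h1 := he x
  have h2 := he y
  have h3 := hH (Nat.div_le_div_right (c := q) hxy)
  omega

/-- The images of the letters under the `q`-uniform morphism `f` have `g`-lengths between `A` and
`B`, and those of their prefixes deviate little from proportionality. -/
def LengthBounds (f : Fin 2 → List (Fin 2)) (q A B : ℕ) (lo hi lo' hi' : ℤ) : Prop :=
  ∀ a, A ≤ gLength (f a) ∧ gLength (f a) ≤ B ∧ ∀ r < q,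
    (lo ≤ (q : ℤ) * gLength ((f a).take r) - A * r ∧
      (q : ℤ) * gLength ((f a).take r) - A * r ≤ hi) ∧
    (lo' ≤ B * r - (q : ℤ) * gLength ((f a).take r) ∧
      B * r - (q : ℤ) * gLength ((f a).take r) ≤ hi')

/-- With S = `blockStart u`, the function q S(x) - A x is a function of `x / q`, increasing because
each image has length at least A, plus a deviation inside one image that lies between `lo` and `hi`.
The upper bound is the same with B x - q S(x). -/
theorem IsUniformFixedPoint.blockStart_bounds {f : Fin 2 → List (Fin 2)} {q : ℕ}
    {u : ℕ → Fin 2} (h : IsUniformFixedPoint f q u) (hq : 0 < q) {A B : ℕ} {lo hi lo' hi' : ℤ}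
    (hb : LengthBounds f q A B lo hi lo' hi') (b d : ℕ) :
    (A : ℤ) * d ≤ q * (blockStart u (b + d) - blockStart u b) + (hi - lo) ∧
      (q : ℤ) * (blockStart u (b + d) - blockStart u b) ≤ B * d + (hi' - lo') := by
  have step : ∀ m, blockStart u (q * (m + 1)) = blockStart u (q * m) + gLength (f (u m)) := by
    intro m
    rw [mul_add, mul_one, blockStart_add_factor, h.factor_eq_take m le_rfl,
      List.take_of_length_le (h.length _).le]
  have val : ∀ x, blockStart u x = blockStart u (q * (x / q)) +
      gLength ((f (u (x / q))).take (x % q)) := by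
    intro x
    rw [← h.factor_eq_take _ (Nat.mod_lt x hq).le, ← blockStart_add_factor, Nat.div_add_mod]
  have hx : ∀ x : ℕ, (x : ℤ) = q * (x / q : ℕ) + (x % q : ℕ) := fun x => by
    exact_mod_cast (Nat.div_add_mod x q).symm
  constructor
  · have := sub_le_of_monotone_add (q := q) (e := fun x => q * blockStart u x - A * x)
      (H := fun m => q * (blockStart u (q * m) - A * m)) (lo := lo) (hi := hi)
      (monotone_nat_of_le_succ fun m => by
        have := (hb (u m)).1
        rw [step]
        push_cast
        nlinarith) (fun x => by
        have h1 := ((hb (u (x / q))).2.2 _ (Nat.mod_lt x hq)).1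
        have h2 := hx x
        rw [val x]
        push_cast at h1 h2 ⊢
        have e : (q : ℤ) * (blockStart u (q * (x / q)) +
            gLength ((f (u (x / q))).take (x % q))) - A * x -
            q * (blockStart u (q * (x / q)) - A * (x / q)) =
            q * gLength ((f (u (x / q))).take (x % q)) - A * (x % q) := by
          linear_combination (-(A : ℤ)) * h2
        rw [e]
        exact h1) (Nat.le_add_right b d)
    push_cast at this
    linarith
  · have := sub_le_of_monotone_add (q := q) (e := fun x => B * x - q * blockStart u x)
      (H := fun m => q * (B * m - blockStart u (q * m))) (lo := lo') (hi := hi')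
      (monotone_nat_of_le_succ fun m => by
        have := (hb (u m)).2.1
        rw [step]
        push_cast
        nlinarith) (fun x => by
        have h1 := ((hb (u (x / q))).2.2 _ (Nat.mod_lt x hq)).2
        have h2 := hx x
        rw [val x]
        push_cast at h1 h2 ⊢
        have e : (B : ℤ) * x - q * (blockStart u (q * (x / q)) +
            gLength ((f (u (x / q))).take (x % q))) -
            q * (B * (x / q) - blockStart u (q * (x / q))) =
            B * (x % q) - q * gLength ((f (u (x / q))).take (x % q)) := by
          linear_combination (B : ℤ) * h2
        rw [e]
        exact h1) (Nat.le_add_right b d)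
    push_cast at this
    linarith

end UndirectedWords

/-! ### Descent through the morphism -/

namespace UndirectedWords

/-! ### Descent for repetitions that preserve the ranking -/

/-- The permutation of places effected by the word `g v`. -/
def wordPerm (n : ℕ) (v : List (Fin 2)) : Equiv.Perm (Fin (n + 4)) := (v.map (blockPerm n)).prod

theorem blockRanking_add (n : ℕ) (u : ℕ → Fin 2) (b d : ℕ) :
    blockRanking n u (b + d) = blockRanking n u b * wordPerm n (factor u b d) := by
  induction d with
  | zero => simp [wordPerm, factor]
  | succ d ih =>
    rw [← add_assoc, blockRanking_succ, ih, factor_add, factor_one, wordPerm, wordPerm,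
      List.map_append, List.prod_append]
    simp [mul_assoc]

/-- Conjugation by `T` telescopes, so the ranking at `q * m` arises from that at `m` by fixed
factors on the left and right. Hence equal rankings at multiples of `q` give equal rankings in the
preimage. -/
theorem IsUniformFixedPoint.blockRanking_mul {f : Fin 2 → List (Fin 2)} {q n : ℕ}
    {u : ℕ → Fin 2} (h : IsUniformFixedPoint f q u) {T : Equiv.Perm (Fin (n + 4))}
    (hT : ∀ a, T * wordPerm n (f a) = blockPerm n a * T) (m : ℕ) :
    blockRanking n u (q * m) =
      blockRanking n u 0 * T⁻¹ * (blockRanking n u 0)⁻¹ * blockRanking n u m * T := by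
  induction m with
  | zero => simp
  | succ m ih =>
    have e : wordPerm n (f (u m)) = T⁻¹ * (blockPerm n (u m) * T) := by
      rw [← hT]
      group
    rw [mul_add, mul_one, blockRanking_add, h.factor_eq_take m le_rfl,
      List.take_of_length_le (h.length _).le, ih, blockRanking_succ, e]
    group

/-- The word `u` has equal factors of length `N` at the positions `b` and `b + P`, and the
rankings there are equal. -/
structure RankedRepetition (n : ℕ) (u : ℕ → Fin 2) (b P N : ℕ) : Prop where
  pos : 0 < P
  ranking : blockRanking n u b = blockRanking n u (b + P)
  factor : ∀ j < N, u (b + j) = u (b + P + j)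

theorem RankedRepetition.word_eq {n : ℕ} {u : ℕ → Fin 2} {b P N : ℕ}
    (h : RankedRepetition n u b P N) (j : ℕ)
    (hj : blockStart u b + j < blockStart u (b + N) + (n + 3)) :
    word n u (blockStart u b + j) = word n u (blockStart u (b + P) + j) := by
  have := word_eq_of_ranking (b' := b + P) (π := 1) h.factor (by simpa using h.ranking) j hj
  simpa using this

/-- Synchronization makes `q` divide `P`. Letters of the preimage agree whenever the repetition
covers a distinguishing position of their images: the last one for the first image, which may be cut
on the left, and position `h` for the others. -/
theorem RankedRepetition.descend {f : Fin 2 → List (Fin 2)} {q n h : ℕ} {u : ℕ → Fin 2}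
    (hu : IsUniformFixedPoint f q u) {T : Equiv.Perm (Fin (n + 4))}
    (hT : ∀ a, T * wordPerm n (f a) = blockPerm n a * T)
    (hsync : ∀ b c, (∀ j < q, u (b + j) = u (c + j)) → b % q = c % q) (hh : h < q)
    (hf : (f 0).getD h 0 ≠ (f 1).getD h 0) (hl : (f 0).getD (q - 1) 0 ≠ (f 1).getD (q - 1) 0)
    {b P N : ℕ} (hr : RankedRepetition n u b P N) (hN : q ≤ N) :
    ∃ b' P' N', RankedRepetition n u b' P' N' ∧ P = q * P' ∧ N ≤ q * N' + h := by
  have inj : ∀ i, (f 0).getD i 0 ≠ (f 1).getD i 0 → ∀ a a' : Fin 2,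
      (f a).getD i 0 = (f a').getD i 0 → a = a' := by
    intro i hi a a' e
    rcases eq_zero_or_one a with rfl | rfl <;> rcases eq_zero_or_one a' with rfl | rfl
    · rfl
    · exact absurd e hi
    · exact absurd e.symm hi
    · rfl
  have hq : 0 < q := by omega
  have hmod := hsync b (b + P) fun j hj => hr.factor j (by omega)
  have hdvd : q ∣ P := by
    have : b ≡ b + P [MOD q] := hmod
    exact (Nat.modEq_zero_iff_dvd).1 (Nat.ModEq.add_left_cancel' b (by simpa using this.symm))
  obtain ⟨P', rfl⟩ := hdvd
  obtain ⟨c, r, hr', rfl⟩ : ∃ c r, r < q ∧ b = q * c + r :=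
    ⟨b / q, b % q, Nat.mod_lt b hq, (Nat.div_add_mod b q).symm⟩
  have shift : ∀ j i, r ≤ q * j + i → i < q → q * j + i < N + r →
      (f (u (c + j))).getD i 0 = (f (u (c + P' + j))).getD i 0 := by
    intro j i h1 h2 h3
    have := hr.factor (q * j + i - r) (by omega)
    rw [show q * c + r + (q * j + i - r) = q * (c + j) + i by rw [mul_add]; omega,
      show q * c + r + q * P' + (q * j + i - r) = q * (c + P' + j) + i by
        rw [mul_add, mul_add]; omega, hu.apply _ _ h2, hu.apply _ _ h2] at this
    exact this
  have match_ : ∀ j, q * j + h < N → u (c + j) = u (c + P' + j) := by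
    intro j hj
    cases j with
    | zero => exact inj _ hl _ _ (shift 0 (q - 1) (by omega) (by omega) (by omega))
    | succ j =>
      refine inj _ hf _ _ (shift (j + 1) h ?_ hh (by omega))
      rw [mul_add]
      omega
  -- The new length is `(N - h) / q` rounded up, the number of `j` with `q * j + h < N`.
  refine ⟨c, P', (N - h + (q - 1)) / q, ⟨?_, ?_, ?_⟩, rfl, ?_⟩
  · exact Nat.pos_of_mul_pos_left hr.pos
  · have h0 : u c = u (c + P') := match_ 0 (by omega)
    have e1 := hr.ranking
    rw [show q * c + r + q * P' = q * (c + P') + r by ring, blockRanking_add n u (q * c),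
      blockRanking_add n u (q * (c + P')), hu.factor_eq_take _ hr'.le, hu.factor_eq_take _ hr'.le,
      ← h0] at e1
    have e2 := mul_right_cancel e1
    rw [hu.blockRanking_mul hT, hu.blockRanking_mul hT] at e2
    exact mul_left_cancel (mul_right_cancel e2)
  · intro j hj
    refine match_ j ?_
    have := Nat.div_mul_le_self (N - h + (q - 1)) q
    have h1 : (j + 1) * q ≤ (N - h + (q - 1)) / q * q := Nat.mul_le_mul_right q hj
    have h2 : (j + 1) * q = q * j + q := by ring
    omega
  · have := Nat.div_add_mod (N - h + (q - 1)) q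
    have := Nat.mod_lt (N - h + (q - 1)) hq
    omega

/-- If repetitions that satisfy a linear inequality are excluded for `N < N₀`, then they are
excluded for all `N`, provided that descent preserves the inequality. -/
theorem not_rankedRepetition {n q h X Y Z N₀ N₁ : ℕ} {u : ℕ → Fin 2} (hq : 1 < q)
    (descend : ∀ {b P N}, RankedRepetition n u b P N → q ≤ N →
      ∃ b' P' N', RankedRepetition n u b' P' N' ∧ P = q * P' ∧ N ≤ q * N' + h)
    (hN₀ : q ≤ N₀) (hN₁ : ∀ N, N₀ ≤ q * N + h → N₁ ≤ N)
    (hZ : Y * h + Z ≤ q * Z)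
    (base : ∀ b P N, N₁ ≤ N → N < N₀ → X * P < Y * N + Z → ¬ RankedRepetition n u b P N)
    (P : ℕ) : ∀ b N, N₁ ≤ N → X * P < Y * N + Z → ¬ RankedRepetition n u b P N := by
  induction P using Nat.strong_induction_on with
  | _ P ih =>
    intro b N h1 h2 h3
    by_cases hN : N < N₀
    · exact base b P N h1 hN h2 h3
    · obtain ⟨b', P', N', h4, rfl, h5⟩ := descend h3 (by omega)
      refine ih P' ?_ b' N' (hN₁ N' (by omega)) ?_ h4
      · have := h4.pos
        nlinarith
      · have h6 : Y * N ≤ Y * (q * N' + h) := Nat.mul_le_mul_left Y h5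
        have h7 : q * (X * P') < q * (Y * N' + Z) := by
          calc q * (X * P') = X * (q * P') := by ring
            _ < Y * N + Z := h2
            _ ≤ Y * (q * N' + h) + Z := by omega
            _ = q * (Y * N') + (Y * h + Z) := by ring
            _ ≤ q * (Y * N') + q * Z := by omega
            _ = q * (Y * N' + Z) := by ring
        exact Nat.lt_of_mul_lt_mul_left h7

/-! ### The word is free of long undirected powers -/

theorem exists_max_block (u : ℕ → Fin 2) {b x : ℕ} (h : blockStart u b < x) :
    ∃ N, blockStart u (b + N) < x ∧ x ≤ blockStart u (b + N) + 3 := by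
  by_contra! hN
  have key : ∀ N, blockStart u (b + N) < x := by
    intro N
    induction N with
    | zero => exact h
    | succ N ih =>
      have := hN N ih
      have := blockStart_add_two_le u (b + N)
      rw [← add_assoc]
      omega
  have := key x
  have := (strictMono_blockStart u).le_apply (x := b + x)
  omega

/-- A repetition in the word yields a repetition in `u` that preserves the ranking. -/
theorem exists_rankedRepetition {n : ℕ} {u : ℕ → Fin 2} {i p l : ℕ} (hp : 0 < p)
    (h : ∀ j < l, word n u (i + j) = word n u (i + p + j)) (hl : n + 5 < l) :
    ∃ b P N, RankedRepetition n u b P N ∧ blockStart u (b + P) = blockStart u b + p ∧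
      l ≤ blockStart u (b + N) - blockStart u b + (n + 8) := by
  -- At most 2 letters are lost before the first block start and 3 after the last; with the window
  -- of `n + 3` letters this gives `n + 8`.
  obtain ⟨b, hb1, hb2⟩ := exists_blockStart_ge u i
  obtain ⟨N, hN1, hN2⟩ := exists_max_block u (b := b) (x := i + l - (n + 3)) (by omega)
  obtain ⟨c, hc1, hc2⟩ := exists_repetition h hb1 N (by omega)
  have hc := hc1 0 (by omega)
  simp only [add_zero] at hc
  have hbc : b < c := (strictMono_blockStart u).lt_iff_lt.1 (by omega)
  have hmono : blockStart u b ≤ blockStart u (b + N) :=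
    (strictMono_blockStart u).monotone (by omega)
  obtain ⟨P, rfl⟩ := Nat.exists_eq_add_of_lt hbc
  refine ⟨b, P + 1, N, ⟨by omega, ?_, hc2⟩, hc, by omega⟩
  refine blockRanking_eq_of_word fun j hj => ?_
  have := h (blockStart u b - i + j) (by omega)
  rw [show b + (P + 1) = b + P + 1 from rfl, hc]
  convert this using 2 <;> omega

/-- If `u` has no reversible factor of length `N`, then reversible factors of the word are
short. -/
theorem length_reversible_le {n N : ℕ} {u : ℕ → Fin 2}
    (hrev : ∀ b c, ¬ ∀ m < N, u (b + m) = u (c + (N - 1 - m))) {i e l : ℕ} (hle : l ≤ e + 1)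
    (h : ∀ j < l, word n u (i + j) = word n u (e - j)) :
    ∃ b, l ≤ blockStart u (b + N) - blockStart u b + (n + 5) := by
  obtain ⟨b, hb1, hb2⟩ := exists_blockStart_ge u i
  refine ⟨b, ?_⟩
  by_contra hl
  have hmono : blockStart u b ≤ blockStart u (b + N) :=
    (strictMono_blockStart u).monotone (by omega)
  obtain ⟨c, hc, -, h2⟩ := exists_reversal hle h hb1 N (by omega)
  refine hrev b (c - N) fun m hm => ?_
  rw [h2 m hm]
  congr 1
  omega

end UndirectedWords

/-! ### Computable decoding and search for repetitions -/

namespace UndirectedWords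

/-! ### Decoding of finite words -/

/-- The letters encoded by `g v`, when the letters are ranked by the given list. -/
def decodeBlocks : List (Fin 2) → List ℕ → List ℕ
  | a :: v, x :: y :: z :: t :: R =>
    bif Nat.beq a 0 then z :: x :: decodeBlocks v (y :: t :: (R ++ [z, x]))
    else z :: x :: t :: decodeBlocks v (y :: (R ++ [z, x, t]))
  | _, _ => []

/-- The ranking `r` as a list. -/
def rankList {n : ℕ} (r : Equiv.Perm (Fin (n + 4))) : List ℕ := List.ofFn fun p => (r p : ℕ)

theorem rankList_eq {n : ℕ} (r : Equiv.Perm (Fin (n + 4))) :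
    rankList r = (r ⟨0, by omega⟩ : ℕ) :: (r ⟨1, by omega⟩ : ℕ) :: (r ⟨2, by omega⟩ : ℕ) ::
      (r ⟨3, by omega⟩ : ℕ) :: List.ofFn fun p : Fin n => (r ⟨p + 4, by omega⟩ : ℕ) := by
  rw [rankList, List.ofFn_succ, List.ofFn_succ, List.ofFn_succ, List.ofFn_succ]
  rfl

theorem length_rankList {n : ℕ} (r : Equiv.Perm (Fin (n + 4))) : (rankList r).length = n + 4 :=
  List.length_ofFn

theorem getElem_rankList {n : ℕ} (r : Equiv.Perm (Fin (n + 4))) (i : ℕ)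
    (hi : i < (rankList r).length) :
    (rankList r)[i] = (r ⟨i, by rwa [length_rankList] at hi⟩ : ℕ) :=
  List.getElem_ofFn hi

theorem rankList_mul_blockPerm_zero {n : ℕ} (r : Equiv.Perm (Fin (n + 4))) :
    rankList (r * blockPerm n 0) = (r ⟨1, by omega⟩ : ℕ) :: (r ⟨3, by omega⟩ : ℕ) ::
      ((List.ofFn fun p : Fin n => (r ⟨p + 4, by omega⟩ : ℕ)) ++
        [(r ⟨2, by omega⟩ : ℕ), (r ⟨0, by omega⟩ : ℕ)]) := by
  apply List.ext_getElem
  · simp [length_rankList]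
  · intro i h1 h2
    have hi : i < n + 4 := by rwa [length_rankList] at h1
    rw [getElem_rankList, Equiv.Perm.mul_apply]
    have val : ∀ c (hc : c < n + 4), (blockPerm n 0 ⟨i, hi⟩ : ℕ) = c →
        (r (blockPerm n 0 ⟨i, hi⟩) : ℕ) = r ⟨c, hc⟩ := fun c hc e => by
      congr 2
      exact Fin.ext e
    simp only [blockPerm_zero, Equiv.Perm.mul_apply, moveToEnd_val] at val ⊢
    match i, hi with
    | 0, _ => rw [val 1 (by omega) (by simp)]; rfl
    | 1, _ => rw [val 3 (by omega) (by simp)]; rfl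
    | i + 2, hi =>
      simp only [List.getElem_cons_succ, List.getElem_append, List.length_ofFn]
      split_ifs with h
      · rw [val (i + 4) (by omega) (by simp; split_ifs <;> omega)]
        simp
      · by_cases h' : i = n
        · subst h'
          rw [val 2 (by omega) (by simp)]
          simp
        · obtain rfl : i = n + 1 := by omega
          rw [val 0 (by omega) (by simp)]
          simp

theorem rankList_mul_blockPerm_one {n : ℕ} (r : Equiv.Perm (Fin (n + 4))) :
    rankList (r * blockPerm n 1) = (r ⟨1, by omega⟩ : ℕ) ::
      ((List.ofFn fun p : Fin n => (r ⟨p + 4, by omega⟩ : ℕ)) ++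
        [(r ⟨2, by omega⟩ : ℕ), (r ⟨0, by omega⟩ : ℕ), (r ⟨3, by omega⟩ : ℕ)]) := by
  apply List.ext_getElem
  · simp [length_rankList]
  · intro i h1 h2
    have hi : i < n + 4 := by rwa [length_rankList] at h1
    rw [getElem_rankList, Equiv.Perm.mul_apply]
    have val : ∀ c (hc : c < n + 4), (blockPerm n 1 ⟨i, hi⟩ : ℕ) = c →
        (r (blockPerm n 1 ⟨i, hi⟩) : ℕ) = r ⟨c, hc⟩ := fun c hc e => by
      congr 2
      exact Fin.ext e
    simp only [blockPerm_one, Equiv.Perm.mul_apply, moveToEnd_val] at val ⊢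
    match i, hi with
    | 0, _ => rw [val 1 (by omega) (by simp)]; rfl
    | i + 1, hi =>
      simp only [List.getElem_cons_succ, List.getElem_append, List.length_ofFn]
      split_ifs with h
      · rw [val (i + 4) (by omega) (by simp; split_ifs <;> omega)]
        simp
      · by_cases h' : i = n
        · subst h'
          rw [val 2 (by omega) (by simp)]
          simp
        · by_cases h'' : i = n + 1
          · subst h''
            rw [val 0 (by omega) (by simp)]
            simp
          · obtain rfl : i = n + 2 := by omega
            rw [val 3 (by omega) (by simp)]
            simp

theorem decodeBlocks_factor (n : ℕ) (u : ℕ → Fin 2) (d : ℕ) : ∀ b,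
    decodeBlocks (factor u b d) (rankList (blockRanking n u b)) =
      (factor (word n u) (blockStart u b + (n + 3))
        (blockStart u (b + d) - blockStart u b)).map Fin.val := by
  induction d with
  | zero =>
    intro b
    simp [factor, decodeBlocks]
  | succ d ih =>
    intro b
    have hs := blockStart_succ u b
    have hle : blockStart u (b + 1) ≤ blockStart u (b + 1 + d) :=
      (strictMono_blockStart u).monotone (by omega)
    have hb := ih (b + 1)
    rw [show b + 1 + d = b + (d + 1) by omega] at hle hb
    rw [add_comm d 1, factor_add, factor_one, List.singleton_append, rankList_eq, decodeBlocks,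
      add_comm 1 d]
    rcases eq_zero_or_one (u b) with h | h
    · have hl : blockStart u (b + (d + 1)) - blockStart u b =
          1 + (1 + (blockStart u (b + (d + 1)) - blockStart u (b + 1))) := by
        simp only [h, Fin.val_zero] at hs
        omega
      rw [← rankList_mul_blockPerm_zero, ← h, ← blockRanking_succ, hb, hl, factor_add, factor_add,
        factor_one, factor_one, h, word_three,
        show blockStart u b + (n + 3) + 1 + 1 = blockStart u (b + 1) + (n + 3) by
          rw [hs, h, Fin.val_zero]; omega, add_assoc _ (n + 3) 1, word_one]
      simp
    · have hl : blockStart u (b + (d + 1)) - blockStart u b =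
          1 + (1 + (1 + (blockStart u (b + (d + 1)) - blockStart u (b + 1)))) := by
        simp only [h, Fin.val_one] at hs
        omega
      rw [← rankList_mul_blockPerm_one, ← h, ← blockRanking_succ, hb, hl, factor_add, factor_add,
        factor_add, factor_one, factor_one, factor_one, h, word_three,
        show blockStart u b + (n + 3) + 1 + 1 + 1 = blockStart u (b + 1) + (n + 3) by
          rw [hs, h, Fin.val_one]; omega, add_assoc _ (n + 3) 1, add_assoc _ (n + 3 + 1) 1,
        word_one, word_two n h]
      simp [show Nat.beq 1 0 = false from rfl]

/-- The prefix of the word encoded by `g v` and by its continuations. -/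
def letters (n : ℕ) (v : List (Fin 2)) : List ℕ :=
  List.range (n + 3) ++ decodeBlocks v ((n + 3) :: List.range (n + 3))

theorem factor_pad (v : List (Fin 2)) : factor (pad v) 0 v.length = v := by
  apply List.ext_getElem
  · simp [length_factor]
  · intro i h1 h2
    simp [factor, pad, h2]

theorem letters_eq (n : ℕ) (v : List (Fin 2)) :
    letters n v = (factor (word n (pad v)) 0 (n + 3 + blockStart (pad v) v.length)).map
      Fin.val := by
  have h := decodeBlocks_factor n (pad v) v.length 0
  rw [factor_pad] at h
  have h0 : blockStart (pad v) 0 = 0 := imageStart_zero g _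
  have e : blockRanking n (pad v) 0 = ranking n (mapWord g (pad v)) 0 :=
    congrArg (ranking n (mapWord g (pad v))) h0
  have h1 : rankList (blockRanking n (pad v) 0) = (n + 3) :: List.range (n + 3) := by
    rw [e]
    apply List.ext_getElem
    · simp [length_rankList]
    · intro i h1 h2
      rw [getElem_rankList]
      cases i with
      | zero =>
        have := ranking_zero_zero n (mapWord g (pad v))
        rw [show (⟨0, by omega⟩ : Fin (n + 4)) = 0 from rfl, this]
        simp
      | succ i =>
        rw [ranking_zero_succ]
        simp
  rw [letters, ← h1, h, factor_add, List.map_append, h0]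
  simp only [zero_add, Nat.sub_zero]
  congr 1
  apply List.ext_getElem
  · simp [length_factor]
  · intro i h1 h2
    simp only [List.length_range] at h1
    simp only [List.getElem_range, factor, List.getElem_map, zero_add]
    exact (decode_of_lt _ h1).symm

theorem getElem?_letters (n : ℕ) (v : List (Fin 2)) {x : ℕ}
    (hx : x < n + 3 + blockStart (pad v) v.length) :
    (letters n v)[x]? = some (word n (pad v) x : ℕ) := by
  rw [letters_eq]
  simp [factor, hx]

/-! ### Search for repetitions by bit masks -/

/-- The value of `f` at `x`, where `x` is evaluated first. -/
def force {α : Type*} (x : ℕ) (f : ℕ → α) : α :=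
  match x with
  | 0 => f 0
  | y + 1 => f (y + 1)

theorem force_eq {α : Type*} (x : ℕ) (f : ℕ → α) : force x f = f x := by
  cases x <;> rfl

/-- The value of `f` at `l`, where the entries of `l` are evaluated first. -/
def forceList {α : Type*} : List ℕ → (List ℕ → α) → α
  | [], f => f []
  | x :: l, f => force x fun x => forceList l fun l => f (x :: l)

theorem forceList_eq {α : Type*} (l : List ℕ) (f : List ℕ → α) : forceList l f = f l := by
  induction l generalizing f with
  | nil => rfl
  | cons x l ih => rw [forceList, force_eq, ih]

/-- The mask of the positions at which the letter `a` occurs in the list, added to `m`, where the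
list is read from position `s` on. -/
def maskFrom (a : ℕ) : List ℕ → ℕ → ℕ → ℕ
  | [], _, m => m
  | x :: l, s, m =>
    force (s + 1) fun s' => force (bif Nat.beq x a then m ||| 2 ^ s else m) fun m' =>
      maskFrom a l s' m'

theorem maskFrom_cons (a x : ℕ) (l : List ℕ) (s m : ℕ) :
    maskFrom a (x :: l) s m = maskFrom a l (s + 1) (bif Nat.beq x a then m ||| 2 ^ s else m) := by
  rw [maskFrom, force_eq, force_eq]

theorem testBit_maskFrom_of_testBit {a : ℕ} (l : List ℕ) :
    ∀ s m i, Nat.testBit m i → Nat.testBit (maskFrom a l s m) i := by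
  induction l with
  | nil => exact fun s m i h => h
  | cons x l ih =>
    intro s m i h
    rw [maskFrom_cons]
    apply ih
    cases Nat.beq x a
    · exact h
    · simp [h]

theorem testBit_maskFrom {a : ℕ} (l : List ℕ) :
    ∀ s m i, l[i]? = some a → Nat.testBit (maskFrom a l s m) (s + i) := by
  induction l with
  | nil => simp
  | cons x l ih =>
    intro s m i h
    rw [maskFrom_cons]
    cases i with
    | zero =>
      apply testBit_maskFrom_of_testBit
      have : x = a := by simpa using h
      simp [this]
    | succ i =>
      rw [show s + (i + 1) = s + 1 + i by omega]
      exact ih _ _ _ (by simpa using h)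

/-- The masks of the letters less than `k`. -/
def masks (k : ℕ) (l : List ℕ) : List ℕ := (List.range k).map fun a => maskFrom a l 0 0

/-- The mask of the positions at which the letter is the same as `d` positions later. -/
def eqMask (ms : List ℕ) (d : ℕ) : ℕ :=
  ms.foldr (fun m r => Nat.lor (Nat.land m (Nat.shiftRight m d)) r) 0

theorem testBit_eqMask_of_mem {ms : List ℕ} {m d i : ℕ} (hm : m ∈ ms) (h : Nat.testBit m i)
    (h' : Nat.testBit m (i + d)) : Nat.testBit (eqMask ms d) i := by
  induction ms with
  | nil => simp at hm
  | cons x ms ih =>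
    change Nat.testBit ((x &&& (x >>> d)) ||| eqMask ms d) i = true
    rw [Nat.testBit_or, Bool.or_eq_true]
    rcases List.mem_cons.1 hm with rfl | hm
    · left
      rw [Nat.testBit_and, Nat.testBit_shiftRight, h, add_comm, h', Bool.and_true]
    · exact Or.inr (ih hm)

theorem testBit_eqMask {k : ℕ} {l : List ℕ} {a d i : ℕ} (ha : a < k) (h : l[i]? = some a)
    (h' : l[i + d]? = some a) : Nat.testBit (eqMask (masks k l) d) i := by
  refine testBit_eqMask_of_mem (m := maskFrom a l 0 0) ?_ ?_ ?_
  · exact List.mem_map.2 ⟨a, List.mem_range.2 ha, rfl⟩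
  · simpa using testBit_maskFrom l 0 0 i h
  · simpa using testBit_maskFrom l 0 0 (i + d) h'

/-- No bit of `T` is the start of a run of `l` bits of `M`. -/
def noRun (M : ℕ) : ℕ → ℕ → Bool
  | 0, T => Nat.beq T 0
  | l + 1, T =>
    match T with
    | 0 => true
    -- Only starts whose bit at distance `l` is set survive; the recursion stops once none is left.
    | T' + 1 => noRun M l (Nat.land (Nat.succ T') (Nat.shiftRight M l))

theorem noRun_eq_false {M i : ℕ} (l : ℕ) : ∀ T, Nat.testBit T i →
    (∀ j < l, Nat.testBit M (i + j)) → noRun M l T = false := by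
  induction l with
  | zero =>
    intro T hT _
    rw [noRun]
    cases T with
    | zero => simp at hT
    | succ T => rfl
  | succ l ih =>
    intro T hT h
    cases T with
    | zero => simp at hT
    | succ T =>
      rw [noRun]
      refine ih _ ?_ fun j hj => h j (by omega)
      refine (Nat.testBit_and _ _ _).trans ?_
      rw [show Nat.testBit (Nat.succ T) i = true from hT, Bool.true_and]
      refine (Nat.testBit_shiftRight _).trans ?_
      rw [add_comm, h l (by omega)]

/-- The least length `l ≥ c` with `A l > p + D`. -/
def badLength (A D c p : ℕ) : ℕ := max c ((p + D) / A + 1)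

/-- There is no repetition with period `p` of `l ≥ c` letters with `A l > p + D` and `p + l ≤ B`. -/
def directCheck (A D c B : ℕ) (ms : List ℕ) : Bool :=
  -- The least forbidden length suffices, since a longer repetition with the same period contains
  -- such a one.
  (List.range B).all fun p => Nat.beq p 0 || Nat.blt B (p + badLength A D c p) ||
    force (eqMask ms p) fun M => noRun M (badLength A D c p) M

/-- No bit of `T` is the start of `l` letters that recur in reverse order at the end of the factor
of length `e` that starts at the same position. -/
def noReversedRun (ms : List ℕ) (e : ℕ) : ℕ → ℕ → Bool
  | 0, T => Nat.beq T 0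
  | l + 1, T =>
    match T with
    | 0 => true
    | T' + 1 =>
      -- The letters at distance `l` from either end of a factor of length `e` are `e - 1 - 2 * l`
      -- apart.
      noReversedRun ms e l (Nat.land (Nat.succ T') (Nat.shiftRight (eqMask ms (e - 1 - 2 * l)) l))

theorem noReversedRun_eq_false {ms : List ℕ} {e i : ℕ} (l : ℕ) : ∀ T, Nat.testBit T i →
    (∀ j < l, Nat.testBit (eqMask ms (e - 1 - 2 * j)) (i + j)) →
      noReversedRun ms e l T = false := by
  induction l with
  | zero =>
    intro T hT _
    rw [noReversedRun]
    cases T with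
    | zero => simp at hT
    | succ T => rfl
  | succ l ih =>
    intro T hT h
    cases T with
    | zero => simp at hT
    | succ T =>
      rw [noReversedRun]
      refine ih _ ?_ fun j hj => h j (by omega)
      refine (Nat.testBit_and _ _ _).trans ?_
      rw [show Nat.testBit (Nat.succ T) i = true from hT, Bool.true_and]
      refine (Nat.testBit_shiftRight _).trans ?_
      rw [add_comm, h l (by omega)]

/-- There is no factor of length `e ≤ B` whose first `l` letters recur in reverse order at its
end, where `A l > e`. -/
def reverseCheck (A B : ℕ) (ms : List ℕ) : Bool :=
  -- For `A > 0`, `e / A + 1` is the least `l` with `A * l > e`. Overlapping ends are skipped, as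
  -- they do not occur in powers xyx'.
  (List.range (B + 1)).all fun e => Nat.blt e (2 * (e / A + 1)) ||
    noReversedRun ms e (e / A + 1) (eqMask ms (e - 1))

theorem directCheck_sound {A D c B k : ℕ} {l : List ℕ} (h : directCheck A D c B (masks k l) = true)
    (hc : 0 < c) {i p m : ℕ} (hp : 0 < p) (hm : c ≤ m) (hB : p + m ≤ B)
    (hl : ∀ j < m, ∃ a < k, l[i + j]? = some a ∧ l[i + p + j]? = some a) : A * m ≤ p + D := by
  by_contra hlt
  rw [not_le] at hlt
  have hA : 0 < A := by
    rcases Nat.eq_zero_or_pos A with rfl | hA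
    · simp at hlt
    · exact hA
  have hbad : badLength A D c p ≤ m := by
    refine max_le hm ?_
    exact Nat.div_lt_of_lt_mul hlt
  have hpos : c ≤ badLength A D c p := le_max_left _ _
  have hb : ∀ j < m, Nat.testBit (eqMask (masks k l) p) (i + j) := by
    intro j hj
    obtain ⟨a, ha, h1, h2⟩ := hl j hj
    exact testBit_eqMask ha h1 (by rwa [add_right_comm])
  have h1 := List.all_eq_true.1 h p (List.mem_range.2 (by omega))
  rw [force_eq, noRun_eq_false (i := i) _ _ (by simpa using hb 0 (by omega))
    fun j hj => hb j (by omega), Bool.or_false, Bool.or_eq_true, Nat.beq_eq, Nat.blt_eq] at h1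
  omega

theorem reverseCheck_sound {A B k : ℕ} {l : List ℕ}
    (h : reverseCheck A B (masks k l) = true) {i e m : ℕ} (hm : 2 * m ≤ e) (hB : e ≤ B)
    (hl : ∀ j < m, ∃ a < k, l[i + j]? = some a ∧ l[i + e - 1 - j]? = some a) : A * m ≤ e := by
  by_contra hlt
  rw [not_le] at hlt
  have hbad : e / A < m := Nat.div_lt_of_lt_mul hlt
  have hpos : 0 < m := (Nat.zero_le _).trans_lt hbad
  have hb : ∀ j < m, Nat.testBit (eqMask (masks k l) (e - 1 - 2 * j)) (i + j) := by
    intro j hj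
    obtain ⟨a, ha, h1, h2⟩ := hl j hj
    refine testBit_eqMask ha h1 ?_
    rwa [show i + j + (e - 1 - 2 * j) = i + e - 1 - j by omega]
  have h1 := List.all_eq_true.1 h e (List.mem_range.2 (by omega))
  rw [noReversedRun_eq_false (i := i) _ _ (by simpa using hb 0 (by omega))
    fun j hj => hb j (by omega), Bool.or_false, Nat.blt_eq] at h1
  omega

/-- The repetitions in the word encoded by `g v` are short, in the sense of `directCheck` and
`reverseCheck`. -/
def repetitionCheck (n A D c B : ℕ) (v : List (Fin 2)) : Bool :=
  forceList (masks (n + 4) (letters n v)) fun ms =>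
    directCheck (n + 2) 0 1 B ms && directCheck A D c B ms && reverseCheck (n + 3) B ms

end UndirectedWords

/-! ### Reduction of freeness to finite checks -/

namespace UndirectedWords

/-! ### Factors of the fixed point -/

/-- The image of `a a'` under `f ^ m`. -/
def pairWord (f : Fin 2 → List (Fin 2)) (m : ℕ) (a a' : Fin 2) : List (Fin 2) :=
  iter f a m ++ iter f a' m

/-- The finite word `v` as a number in binary notation. -/
def binaryCode (v : List (Fin 2)) : ℕ := v.foldl (fun c a => 2 * c + a) 0

/-- The factors of length `N` of the word that start at its first `Q` positions, tagged by their
position, which is counted from `s` on. -/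
def windowsFrom (N : ℕ) : ℕ → ℕ → List (Fin 2) → List (List (Fin 2) × ℕ)
  | Q + 1, s, a :: v => ((a :: v).take N, s) :: windowsFrom N Q (s + 1) v
  | _, _, _ => []

theorem mem_windowsFrom {N : ℕ} : ∀ {Q s r : ℕ} {v : List (Fin 2)}, r < Q → r < v.length →
    ((v.drop r).take N, s + r) ∈ windowsFrom N Q s v
  | Q + 1, s, 0, a :: v, _, _ => by simp [windowsFrom]
  | Q + 1, s, r + 1, a :: v, h, h' => by
    rw [windowsFrom, List.drop_succ_cons, show s + (r + 1) = s + 1 + r by omega]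
    exact List.mem_cons_of_mem _ (mem_windowsFrom (by omega) (by simpa using h'))

/-- The factors of length `N` of the images under `f ^ m` of words of length two that start at the
first `Q` positions, tagged by their position. -/
def windows (f : Fin 2 → List (Fin 2)) (m Q N : ℕ) : List (List (Fin 2) × ℕ) :=
  [(0, 0), (0, 1), (1, 0), (1, 1)].flatMap fun p => windowsFrom N Q 0 (pairWord f m p.1 p.2)

theorem IsUniformFixedPoint.factor_mem_windows {f : Fin 2 → List (Fin 2)} {q m N : ℕ}
    {u : ℕ → Fin 2} (hu : IsUniformFixedPoint f q u) (hq : 0 < q) (hN : N ≤ q ^ m + 1) (b : ℕ) :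
    (factor u b N, b % q ^ m) ∈ windows f m (q ^ m) N := by
  have hQ : 0 < q ^ m := pow_pos hq m
  obtain ⟨a, a', h⟩ := (hu.iterate m).exists_pair hQ b
  have hr := Nat.mod_lt b hQ
  have hlen : (pairWord f m a a').length = q ^ m + q ^ m := by
    simp [pairWord, length_iter hu.length]
  have e : factor u b N = ((pairWord f m a a').drop (b % q ^ m)).take N := by
    refine List.ext_getElem ?_ fun i h1 h2 => ?_
    · simp only [List.length_take, List.length_drop, length_factor, hlen]
      omega
    · simp only [length_factor] at h1
      simp only [List.getElem_take, List.getElem_drop, factor, List.getElem_map,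
        List.getElem_range]
      rw [h i (by omega), pad, ← pairWord, List.getD_eq_getElem _ _ (by omega)]
  rw [windows, List.mem_flatMap]
  refine ⟨(a, a'), ?_, ?_⟩
  · rcases eq_zero_or_one a with rfl | rfl <;> rcases eq_zero_or_one a' with rfl | rfl <;> simp
  · have := mem_windowsFrom (N := N) (s := 0) (v := pairWord f m a a') hr (by omega)
    rwa [zero_add, ← e] at this

/-- Equal factors of length `q` start at positions that are congruent modulo `q`. -/
def syncCheck (f : Fin 2 → List (Fin 2)) (q : ℕ) : Bool :=
  -- Positions are below `q`, so a factor and its position fit into one number and are recovered by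
  -- division.
  forceList ((windows f 1 q q).map fun x => q * binaryCode x.1 + x.2) fun l =>
    l.all fun x => l.all fun y => !Nat.beq (x / q) (y / q) || Nat.beq (x % q) (y % q)

theorem IsUniformFixedPoint.sync {f : Fin 2 → List (Fin 2)} {q : ℕ} {u : ℕ → Fin 2}
    (hu : IsUniformFixedPoint f q u) (hq : 0 < q) (h : syncCheck f q = true) (b c : ℕ)
    (hbc : ∀ j < q, u (b + j) = u (c + j)) : b % q = c % q := by
  have mem : ∀ b, q * binaryCode (factor u b q) + b % q ∈
      (windows f 1 q q).map fun x => q * binaryCode x.1 + x.2 := by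
    intro b
    have := hu.factor_mem_windows (m := 1) (N := q) hq (by simp) b
    rw [pow_one] at this
    exact List.mem_map.2 ⟨_, this, rfl⟩
  rw [syncCheck, forceList_eq] at h
  have := List.all_eq_true.1 (List.all_eq_true.1 h _ (mem b)) _ (mem c)
  have e : factor u b q = factor u c q := by
    simp only [factor]
    exact List.map_congr_left fun j hj => hbc j (List.mem_range.1 hj)
  rw [e] at this
  simpa [Nat.mul_add_div hq, Nat.mod_div_self] using this

/-- The entries of `l` and of `l'`, without repeated entries of `l`. -/
def addNew : List ℕ → List ℕ → List ℕ
  | [], l' => l'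
  | x :: l, l' => bif l'.any (Nat.beq x) then addNew l l' else addNew l (x :: l')

theorem mem_addNew {x : ℕ} (l : List ℕ) : ∀ l', x ∈ l ∨ x ∈ l' → x ∈ addNew l l' := by
  induction l with
  | nil => simp [addNew]
  | cons y l ih =>
    intro l' h
    rw [addNew]
    cases hy : l'.any (Nat.beq y)
    · refine ih _ ?_
      simp only [List.mem_cons] at h ⊢
      tauto
    · refine ih _ ?_
      rcases h with h | h
      · rcases List.mem_cons.1 h with rfl | h
        · obtain ⟨z, hz, e⟩ := List.any_eq_true.1 hy
          exact Or.inr (Nat.eq_of_beq_eq_true e ▸ hz)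
        · exact Or.inl h
      · exact Or.inr h

/-- No factor of length `N` is the reversal of a factor. -/
def reversibleCheck (f : Fin 2 → List (Fin 2)) (m Q N : ℕ) : Bool :=
  forceList ((windows f m Q N).map fun x => binaryCode x.1) fun l =>
    forceList ((windows f m Q N).map fun x => binaryCode x.1.reverse) fun l' =>
      forceList (addNew l []) fun l => forceList (addNew l' []) fun l' =>
        l.all fun x => l'.all fun y => !Nat.beq x y

theorem IsUniformFixedPoint.not_reversible {f : Fin 2 → List (Fin 2)} {q m N : ℕ}
    {u : ℕ → Fin 2} (hu : IsUniformFixedPoint f q u) (hq : 0 < q) (hN : N ≤ q ^ m + 1)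
    (h : reversibleCheck f m (q ^ m) N = true) (b c : ℕ) :
    ¬ ∀ j < N, u (b + j) = u (c + (N - 1 - j)) := by
  intro hbc
  rw [reversibleCheck, forceList_eq, forceList_eq, forceList_eq, forceList_eq] at h
  have := List.all_eq_true.1 (List.all_eq_true.1 h _ (mem_addNew _ _ <| Or.inl <|
    List.mem_map.2 ⟨_, hu.factor_mem_windows hq hN b, rfl⟩)) _ (mem_addNew _ _ <| Or.inl <|
    List.mem_map.2 ⟨_, hu.factor_mem_windows hq hN c, rfl⟩)
  have e : factor u b N = (factor u c N).reverse := by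
    apply List.ext_getElem
    · simp [length_factor]
    · intro i h1 h2
      rw [length_factor] at h1
      simp only [factor, List.getElem_reverse, List.getElem_map, List.getElem_range,
        List.length_map, List.length_range]
      exact hbc i h1
  simp [e] at this

/-! ### Short repetitions -/

/-- Any `B` consecutive letters start at most 2 places after a block start, so they lie in the part
governed by `q ^ m + 1` blocks. These blocks occur in some f^m(aa'), which encodes the same letters
up to a permutation, and equality of letters ignores permutations. -/
theorem IsUniformFixedPoint.exists_letters {f : Fin 2 → List (Fin 2)} {q m n B : ℕ}
    {u : ℕ → Fin 2} (hu : IsUniformFixedPoint f q u) (hq : 0 < q)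
    (hB : ∀ b, blockStart u b + (B + 2) ≤ blockStart u (b + (q ^ m + 1)) + (n + 3)) (i : ℕ) :
    ∃ a a' i', ∀ x y, x < B → y < B → word n u (i + x) = word n u (i + y) →
      ∃ c < n + 4, (letters n (pairWord f m a a'))[i' + x]? = some c ∧
        (letters n (pairWord f m a a'))[i' + y]? = some c := by
  have hQ : 0 < q ^ m := pow_pos hq m
  obtain ⟨b, hb⟩ := exists_blockStart u i
  obtain ⟨o, ho, rfl⟩ : ∃ o ≤ 2, i = blockStart u b + o := by
    rcases hb with h | h | ⟨h, -⟩
    · exact ⟨0, by omega, h⟩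
    · exact ⟨1, by omega, h⟩
    · exact ⟨2, by omega, h⟩
  obtain ⟨a, a', h⟩ := (hu.iterate m).exists_pair hQ b
  obtain ⟨π, hπ⟩ := exists_perm_word n h
  have hS := blockStart_add_eq h _ le_rfl
  have hr := Nat.mod_lt b hQ
  set v := pairWord f m a a' with hv
  have hlen : v.length = q ^ m + q ^ m := by
    simp [hv, pairWord, length_iter hu.length]
  have hmono : blockStart (pad v) (b % q ^ m + (q ^ m + 1)) ≤ blockStart (pad v) v.length :=
    (strictMono_blockStart _).monotone (by omega)
  refine ⟨a, a', blockStart (pad v) (b % q ^ m) + o, fun x y hx hy e => ?_⟩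
  have h1 := hB b
  change ∀ j, _ → _ = π (word n (pad v) (blockStart (pad v) (b % q ^ m) + j)) at hπ
  change _ + blockStart (pad v) (b % q ^ m) =
    _ + blockStart (pad v) (b % q ^ m + (q ^ m + 1)) at hS
  rw [add_assoc, add_assoc, hπ _ (by omega), hπ _ (by omega)] at e
  have e := π.injective e
  refine ⟨_, (word n (pad v) (blockStart (pad v) (b % q ^ m) + (o + x))).isLt, ?_, ?_⟩
  · rw [add_assoc, ← hv, getElem?_letters]
    omega
  · rw [add_assoc, ← hv, getElem?_letters, e]
    omega

/-- Repetitions of total length at most `B` are short. -/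
structure ShortRepetitions (n A D c B : ℕ) (u : ℕ → Fin 2) : Prop where
  direct : ∀ i p l, 0 < p → 0 < l → p + l ≤ B →
    (∀ j < l, word n u (i + j) = word n u (i + p + j)) → (n + 2) * l ≤ p
  direct_of_le : ∀ i p l, 0 < p → c ≤ l → p + l ≤ B →
    (∀ j < l, word n u (i + j) = word n u (i + p + j)) → A * l ≤ p + D
  reverse : ∀ i e l, 2 * l ≤ e → e ≤ B →
    (∀ j < l, word n u (i + j) = word n u (i + e - 1 - j)) → (n + 3) * l ≤ e

theorem IsUniformFixedPoint.shortRepetitions {f : Fin 2 → List (Fin 2)} {q m n A D c B : ℕ}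
    {u : ℕ → Fin 2} (hu : IsUniformFixedPoint f q u) (hq : 0 < q) (hc : 0 < c)
    (hB : ∀ b, blockStart u b + (B + 2) ≤ blockStart u (b + (q ^ m + 1)) + (n + 3))
    (h : ∀ a a', repetitionCheck n A D c B (pairWord f m a a') = true) :
    ShortRepetitions n A D c B u := by
  have h' : ∀ a a',
      (directCheck (n + 2) 0 1 B (masks (n + 4) (letters n (pairWord f m a a'))) = true ∧
      directCheck A D c B (masks (n + 4) (letters n (pairWord f m a a'))) = true) ∧
      reverseCheck (n + 3) B (masks (n + 4) (letters n (pairWord f m a a'))) = true := by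
    intro a a'
    have := h a a'
    rwa [repetitionCheck, forceList_eq, Bool.and_eq_true, Bool.and_eq_true] at this
  refine ⟨fun i p l hp hl hpl hr => ?_, fun i p l hp hl hpl hr => ?_, fun i e l hl he hr => ?_⟩
  · obtain ⟨a, a', i', hi'⟩ := hu.exists_letters hq hB i
    refine directCheck_sound (h' a a').1.1 one_pos (i := i') hp hl hpl fun j hj => ?_
    rw [add_assoc i']
    exact hi' j (p + j) (by omega) (by omega) (by rw [← add_assoc]; exact hr j hj)
  · obtain ⟨a, a', i', hi'⟩ := hu.exists_letters hq hB i
    refine directCheck_sound (h' a a').1.2 hc (i := i') hp hl hpl fun j hj => ?_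
    rw [add_assoc i']
    exact hi' j (p + j) (by omega) (by omega) (by rw [← add_assoc]; exact hr j hj)
  · obtain ⟨a, a', i', hi'⟩ := hu.exists_letters hq hB i
    refine reverseCheck_sound (h' a a').2 (i := i') hl he fun j hj => ?_
    rw [show i' + e - 1 - j = i' + (e - 1 - j) by omega]
    refine hi' j (e - 1 - j) (by omega) (by omega) ?_
    rw [hr j hj]
    congr 1
    omega

/-! ### Undirected powers -/

/-- With l = |x| and p = |xy|, the exponent is 1 + l/p, which exceeds (k-1)/(k-2) exactly when (k-2)
l > p. -/
theorem undirectedPlusFree_of_repetitions {n : ℕ} {w : ℕ → Fin (n + 4)}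
    (hd : ∀ i p l, 0 < l → l ≤ p → (∀ j < l, w (i + j) = w (i + p + j)) → (n + 2) * l ≤ p)
    (hr : ∀ i p l, 0 < l → l ≤ p → (∀ j < l, w (i + j) = w (i + (p + l) - 1 - j)) →
      (n + 2) * l ≤ p) :
    UndirectedPlusFree ((((n + 4 : ℕ) : ℝ) - 1) / (((n + 4 : ℕ) : ℝ) - 2)) w := by
  rintro v ⟨i, N, rfl⟩ r hlt ⟨x, y, x', hx, hxx', hv, rfl⟩
  have hl : x'.length = x.length := by
    rcases hxx' with rfl | rfl
    · rfl
    · simp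
  have hpos : 0 < x.length := List.length_pos_iff.2 hx
  set l := x.length with hl_def
  set p := (x ++ y).length with hp_def
  have hlp : l ≤ p := by simp [hp_def, hl_def]
  have hN : N = p + l := by
    rw [← length_factor w i N, hv, List.length_append, hl]
  have get : ∀ j < N, some (w (i + j)) = (x ++ y ++ x')[j]? := by
    intro j hj
    simp [← hv, factor, hj]
  have get_left : ∀ j < l, some (w (i + j)) = x[j]? := by
    intro j hj
    rw [get j (by omega), List.getElem?_append_left (by omega), List.getElem?_append_left hj]
  have get_right : ∀ j < l, some (w (i + (p + j))) = x'[j]? := by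
    intro j hj
    rw [get (p + j) (by omega), List.getElem?_append_right (by omega), ← hp_def,
      Nat.add_sub_cancel_left]
  have key : (n + 2) * l ≤ p := by
    rcases hxx' with e | e
    · refine hd i p l hpos hlp fun j hj => Option.some_injective _ ?_
      rw [add_assoc, get_left j hj, get_right j hj, e]
    · refine hr i p l hpos hlp fun j hj => Option.some_injective _ ?_
      rw [show i + (p + l) - 1 - j = i + (p + (l - 1 - j)) by omega, get_left j hj,
        get_right _ (by omega), e, List.getElem?_reverse (by omega)]
      congr 1
      omega
  have hp0 : (0 : ℝ) < p := by exact_mod_cast hpos.trans_le hlp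
  have hlen : (x ++ y ++ x').length = p + l := by rw [List.length_append, hl]
  rw [hlen] at hlt
  push_cast at hlt
  rw [div_lt_div_iff₀ (by linarith [(Nat.cast_nonneg n : (0 : ℝ) ≤ n)]) hp0] at hlt
  have key' : ((n : ℝ) + 2) * l ≤ p := by exact_mod_cast key
  nlinarith

/-- A power violating the bound has total length less than `(n + 3) * l`. For reversed powers, and
for direct ones with few blocks, this is at most `B` and `hS` applies; the remaining direct ones are
excluded by descent. -/
theorem IsUniformFixedPoint.undirectedPlusFree {f : Fin 2 → List (Fin 2)}
    {q n h A D c B N₀ N₁ NR X Y Z Z₀ : ℕ} {u : ℕ → Fin 2}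
    (hu : IsUniformFixedPoint f q u) {T : Equiv.Perm (Fin (n + 4))}
    (hT : ∀ a, T * wordPerm n (f a) = blockPerm n a * T)
    (hsync : ∀ b c, (∀ j < q, u (b + j) = u (c + j)) → b % q = c % q) (hq : 1 < q) (hh : h < q)
    (hf : (f 0).getD h 0 ≠ (f 1).getD h 0) (hl : (f 0).getD (q - 1) 0 ≠ (f 1).getD (q - 1) 0)
    (hrev : ∀ b c, ¬ ∀ m < NR, u (b + m) = u (c + (NR - 1 - m)))
    (hS : ShortRepetitions n A D c B u)
    (hB : (n + 3) * (n + 5) ≤ B)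
    (hB₀ : ∀ b N, N < N₀ → (n + 3) * (blockStart u (b + N) - blockStart u b + (n + 8)) ≤ B)
    (hBR : ∀ b, (n + 3) * (blockStart u (b + NR) - blockStart u b + (n + 5)) ≤ B)
    (hN₀ : q ≤ N₀) (hN₁ : ∀ N, N₀ ≤ q * N + h → N₁ ≤ N)
    (hZ₀ : Y * h + Z₀ ≤ q * Z) (hZ : Y * h + Z ≤ q * Z)
    (start : ∀ b P N l, N₀ ≤ N → blockStart u (b + P) - blockStart u b < (n + 2) * l →
      l ≤ blockStart u (b + N) - blockStart u b + (n + 8) → X * P < Y * N + Z₀)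
    (base : ∀ b P N, N₁ ≤ N → N < N₀ → X * P < Y * N + Z → ¬ RankedRepetition n u b P N) :
    UndirectedPlusFree ((((n + 4 : ℕ) : ℝ) - 1) / (((n + 4 : ℕ) : ℝ) - 2)) (word n u) := by
  have descend : ∀ {b P N}, RankedRepetition n u b P N → q ≤ N →
      ∃ b' P' N', RankedRepetition n u b' P' N' ∧ P = q * P' ∧ N ≤ q * N' + h :=
    fun hr hN => hr.descend hu hT hsync hh hf hl hN
  have none := not_rankedRepetition hq descend hN₀ hN₁ hZ base
  refine undirectedPlusFree_of_repetitions ?_ ?_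
  · intro i p l hl0 hlp hr
    by_contra hlt
    rw [not_le] at hlt
    have big : ∀ x, l ≤ x → (n + 3) * x ≤ B → False := by
      intro x hx hxB
      have h1 : (n + 3) * l ≤ (n + 3) * x := Nat.mul_le_mul_left _ hx
      have h2 : (n + 3) * l = (n + 2) * l + l := by ring
      have := hS.direct i p l (by omega) hl0 (by omega) hr
      omega
    have hl5 : n + 5 < l := by
      by_contra h5
      exact big (n + 5) (by omega) hB
    obtain ⟨b, P, N, hR, hp, hlN⟩ := exists_rankedRepetition (by omega) hr hl5
    have hN : N₀ ≤ N := by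
      by_contra hN
      exact big _ hlN (hB₀ b N (by omega))
    have hXP := start b P N l hN (by omega) hlN
    -- The letters lost in passing to blocks make `Z₀` larger than `Z`; one descent divides this
    -- error by `q`.
    obtain ⟨b', P', N', hR', rfl, hN'⟩ := descend hR (by omega)
    refine none P' b' N' (hN₁ N' (by omega)) ?_ hR'
    have h6 : Y * N ≤ Y * (q * N' + h) := Nat.mul_le_mul_left Y hN'
    have h7 : q * (X * P') < q * (Y * N' + Z) := by
      calc q * (X * P') = X * (q * P') := by ring
        _ < Y * N + Z₀ := hXP
        _ ≤ Y * (q * N' + h) + Z₀ := by omega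
        _ = q * (Y * N') + (Y * h + Z₀) := by ring
        _ ≤ q * (Y * N') + q * Z := by omega
        _ = q * (Y * N' + Z) := by ring
    exact Nat.lt_of_mul_lt_mul_left h7
  · intro i p l hl0 hlp hr
    by_contra hlt
    rw [not_le] at hlt
    obtain ⟨b, hb⟩ := length_reversible_le (i := i) (e := i + (p + l) - 1) hrev (by omega) hr
    have h1 : (n + 3) * l ≤ (n + 3) * (blockStart u (b + NR) - blockStart u b + (n + 5)) :=
      Nat.mul_le_mul_left _ hb
    have h2 : (n + 3) * l = (n + 2) * l + l := by ring
    have h3 := hBR b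
    have := hS.reverse i (p + l) l (by omega) (by omega) hr
    omega

end UndirectedWords

/-! ### The three morphisms and their constants -/

namespace UndirectedWords

instance (f : Fin 2 → List (Fin 2)) (q A B : ℕ) (lo hi lo' hi' : ℤ) :
    Decidable (LengthBounds f q A B lo hi lo' hi') := by
  unfold LengthBounds
  infer_instance

/-! ### The alphabet of four letters -/

/-- The conjugating permutation for `f4`. -/
def conj4 : Equiv.Perm (Fin 4) where
  toFun := ![0, 3, 1, 2]
  invFun := ![0, 2, 3, 1]
  left_inv := by decide
  right_inv := by decide

theorem isUniformFixedPoint_f4 : IsUniformFixedPoint f4 3 (omegaWord f4 0) :=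
  isUniformFixedPoint_omegaWord (by omega) (by decide) (by decide)

/-- Here 156 = 3 · 52, where 52 bounds the length of a repetition with fewer than 18 blocks. For
four letters `2 * l ≤ p` would not suffice in the base case of the descent; the sharper `3 * l ≤ p +
5` for `l ≥ 15` does. -/
theorem repetitionCheck_f4 : ∀ a a', repetitionCheck 0 3 5 15 156 (pairWord f4 4 a a') = true := by
  decide +kernel

/-- The third iterate, whose images of 27 letters have g-lengths 67 and 68, gives closer slopes than
7/3 and 8/3 from `f4` itself. -/
theorem blockStart_bounds_f4 (b d : ℕ) :
    67 * (d : ℤ) ≤ 27 * (blockStart (omegaWord f4 0) (b + d) - blockStart (omegaWord f4 0) b) + 47 ∧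
      27 * ((blockStart (omegaWord f4 0) (b + d) : ℤ) - blockStart (omegaWord f4 0) b) ≤
        68 * d + 47 := by
  have h : LengthBounds (fun a => iter f4 a 3) (3 ^ 3) 67 68 (-34) 13 0 47 := by
    decide +kernel
  have := (isUniformFixedPoint_f4.iterate 3).blockStart_bounds (by norm_num) h b d
  norm_num at this
  exact this

theorem conj4_mul (a : Fin 2) : conj4 * wordPerm 0 (f4 a) = blockPerm 0 a * conj4 := by
  apply Equiv.ext
  revert a
  decide +kernel

theorem undirectedPlusFree_f4 :
    UndirectedPlusFree ((((0 + 4 : ℕ) : ℝ) - 1) / (((0 + 4 : ℕ) : ℝ) - 2))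
      (word 0 (omegaWord f4 0)) := by
  have hu := isUniformFixedPoint_f4
  have bd := blockStart_bounds_f4
  have hS : ShortRepetitions 0 3 5 15 156 (omegaWord f4 0) :=
    hu.shortRepetitions (m := 4) (by omega) (by omega) (fun b => by
      -- 82 = 3 ^ 4 + 1.
      have := bd b 82
      norm_num
      omega) repetitionCheck_f4
  -- The images differ only in their last letter, so `h = 2`. The length bounds and p ≤ 2l - 1 give
  -- 67 P < 136 N + 547, where 136 = 2 · 68, and 273 = (2 · 136 + 547) / 3. The value 18 is the
  -- least `N₀` for which a descent from `N ≥ N₀` leaves at least 6 letters, as the base case needs.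
  refine hu.undirectedPlusFree (h := 2) (N₀ := 18) (N₁ := 6) (NR := 8) (X := 67) (Y := 136)
    (Z := 273) (Z₀ := 547) conj4_mul (hu.sync (by omega) (by decide +kernel)) (by omega) (by omega)
    (by decide) (by decide)
    (hu.not_reversible (m := 2) (by omega) (by norm_num) (by decide +kernel)) hS
    (by omega) (fun b N hN => ?_) (fun b => ?_) (by omega) (fun N hN => by omega) (by omega)
    (by omega) (fun b P N l hN hP hl => ?_) (fun b P N h1 h2 h3 hR => ?_)
  · have := bd b N
    omega
  · have := bd b 8
    omega
  · have := bd b N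
    have := bd b P
    omega
  · have hN := bd b N
    have hP := bd b P
    have hpos := hR.pos
    have hlt := strictMono_blockStart (omegaWord f4 0) (show b < b + P by omega)
    have hle := (strictMono_blockStart (omegaWord f4 0)).monotone (show b ≤ b + N by omega)
    -- Equal rankings repeat the `n + 3` window letters as well, hence the `+ 3`.
    have := hS.direct_of_le (blockStart (omegaWord f4 0) b)
      (blockStart (omegaWord f4 0) (b + P) - blockStart (omegaWord f4 0) b)
      (blockStart (omegaWord f4 0) (b + N) - blockStart (omegaWord f4 0) b + 3)
      (by omega) (by omega) (by omega) (fun j hj => by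
        rw [hR.word_eq j (by omega)]
        congr 1
        omega)
    omega

/-! ### The alphabet of eight letters -/

/-- The conjugating permutation for `f8`. -/
def conj8 : Equiv.Perm (Fin 8) where
  toFun := ![2, 7, 4, 5, 3, 6, 0, 1]
  invFun := ![6, 7, 0, 4, 2, 3, 5, 1]
  left_inv := by decide
  right_inv := by decide

theorem isUniformFixedPoint_f8 : IsUniformFixedPoint f8 15 (omegaWord f8 0) :=
  isUniformFixedPoint_omegaWord (by omega) (by decide) (by decide)

theorem repetitionCheck_f8 : ∀ a a', repetitionCheck 4 6 0 1 497 (pairWord f8 2 a a') = true := by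
  decide +kernel

theorem blockStart_bounds_f8 (b d : ℕ) :
    37 * (d : ℤ) ≤ 15 * (blockStart (omegaWord f8 0) (b + d) - blockStart (omegaWord f8 0) b) + 32 ∧
      15 * ((blockStart (omegaWord f8 0) (b + d) : ℤ) - blockStart (omegaWord f8 0) b) ≤
        38 * d + 29 := by
  have h : LengthBounds f8 15 37 38 (-11) 21 (-9) 20 := by
    decide +kernel
  have := isUniformFixedPoint_f8.blockStart_bounds (by norm_num) h b d
  norm_num at this
  exact this

theorem conj8_mul (a : Fin 2) : conj8 * wordPerm 4 (f8 a) = blockPerm 4 a * conj8 := by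
  apply Equiv.ext
  revert a
  decide +kernel

theorem undirectedPlusFree_f8 :
    UndirectedPlusFree ((((4 + 4 : ℕ) : ℝ) - 1) / (((4 + 4 : ℕ) : ℝ) - 2))
      (word 4 (omegaWord f8 0)) := by
  have hu := isUniformFixedPoint_f8
  have bd := blockStart_bounds_f8
  have hS : ShortRepetitions 4 6 0 1 497 (omegaWord f8 0) :=
    hu.shortRepetitions (m := 2) (by omega) (by omega) (fun b => by
      have := bd b 226
      norm_num
      omega) repetitionCheck_f8
  -- Now the first letters differ. Again Y = 6 · 38 and `Z₀` come from the length bounds, and `Z` is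
  -- 1272 / 15 rounded up. The bound 497 = 7 · 71 is dictated by reversed factors of 24 blocks.
  refine hu.undirectedPlusFree (h := 0) (N₀ := 15) (N₁ := 1) (NR := 24) (X := 37) (Y := 228)
    (Z := 85) (Z₀ := 1272) conj8_mul (hu.sync (by omega) (by decide +kernel)) (by omega) (by omega)
    (by decide) (by decide)
    (hu.not_reversible (m := 2) (by omega) (by norm_num) (by decide +kernel)) hS
    (by omega) (fun b N hN => ?_) (fun b => ?_) (by omega) (fun N hN => by omega) (by omega)
    (by omega) (fun b P N l hN hP hl => ?_) (fun b P N h1 h2 h3 hR => ?_)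
  · have := bd b N
    omega
  · have := bd b 24
    omega
  · have := bd b N
    have := bd b P
    omega
  · have hN := bd b N
    have hP := bd b P
    have hpos := hR.pos
    have hlt := strictMono_blockStart (omegaWord f8 0) (show b < b + P by omega)
    have hle := (strictMono_blockStart (omegaWord f8 0)).monotone (show b ≤ b + N by omega)
    have := hS.direct_of_le (blockStart (omegaWord f8 0) b)
      (blockStart (omegaWord f8 0) (b + P) - blockStart (omegaWord f8 0) b)
      (blockStart (omegaWord f8 0) (b + N) - blockStart (omegaWord f8 0) b + 7)
      (by omega) (by omega) (by omega) (fun j hj => by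
        rw [hR.word_eq j (by omega)]
        congr 1
        omega)
    omega

/-! ### The alphabet of twelve letters -/

/-- The conjugating permutation for `f12`. -/
def conj12 : Equiv.Perm (Fin 12) where
  toFun := ![5, 3, 9, 1, 11, 0, 7, 4, 10, 6, 8, 2]
  invFun := ![5, 3, 11, 1, 7, 0, 9, 6, 10, 2, 8, 4]
  left_inv := by decide
  right_inv := by decide

theorem isUniformFixedPoint_f12 : IsUniformFixedPoint f12 21 (omegaWord f12 0) :=
  isUniformFixedPoint_omegaWord (by omega) (by decide) (by decide)

theorem repetitionCheck_f12 :
    ∀ a a', repetitionCheck 8 10 0 1 748 (pairWord f12 2 a a') = true := by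
  decide +kernel

theorem blockStart_bounds_f12 (b d : ℕ) :
    52 * (d : ℤ) ≤
      21 * (blockStart (omegaWord f12 0) (b + d) - blockStart (omegaWord f12 0) b) + 39 ∧
      21 * ((blockStart (omegaWord f12 0) (b + d) : ℤ) - blockStart (omegaWord f12 0) b) ≤
        53 * d + 47 := by
  have h : LengthBounds f12 21 52 53 (-15) 24 (-18) 29 := by
    decide +kernel
  have := isUniformFixedPoint_f12.blockStart_bounds (by norm_num) h b d
  norm_num at this
  exact this

theorem conj12_mul (a : Fin 2) : conj12 * wordPerm 8 (f12 a) = blockPerm 8 a * conj12 := by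
  apply Equiv.ext
  revert a
  decide +kernel

theorem undirectedPlusFree_f12 :
    UndirectedPlusFree ((((8 + 4 : ℕ) : ℝ) - 1) / (((8 + 4 : ℕ) : ℝ) - 2))
      (word 8 (omegaWord f12 0)) := by
  have hu := isUniformFixedPoint_f12
  have bd := blockStart_bounds_f12
  have hS : ShortRepetitions 8 10 0 1 748 (omegaWord f12 0) :=
    hu.shortRepetitions (m := 2) (by omega) (by omega) (fun b => by
      have := bd b 442
      norm_num
      omega) repetitionCheck_f12
  -- Similarly Y = 10 · 53, and `Z` is 3849 / 21 rounded up; 748 = 11 · 68 comes from direct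
  -- repetitions of at most 20 blocks.
  refine hu.undirectedPlusFree (h := 0) (N₀ := 21) (N₁ := 1) (NR := 20) (X := 52) (Y := 530)
    (Z := 184) (Z₀ := 3849) conj12_mul (hu.sync (by omega) (by decide +kernel)) (by omega)
    (by omega) (by decide) (by decide)
    (hu.not_reversible (m := 1) (by omega) (by norm_num) (by decide +kernel)) hS
    (by omega) (fun b N hN => ?_) (fun b => ?_) (by omega) (fun N hN => by omega) (by omega)
    (by omega) (fun b P N l hN hP hl => ?_) (fun b P N h1 h2 h3 hR => ?_)
  · have := bd b N
    omega
  · have := bd b 20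
    omega
  · have := bd b N
    have := bd b P
    omega
  · have hN := bd b N
    have hP := bd b P
    have hpos := hR.pos
    have hlt := strictMono_blockStart (omegaWord f12 0) (show b < b + P by omega)
    have hle := (strictMono_blockStart (omegaWord f12 0)).monotone (show b ≤ b + N by omega)
    have := hS.direct_of_le (blockStart (omegaWord f12 0) b)
      (blockStart (omegaWord f12 0) (b + P) - blockStart (omegaWord f12 0) b)
      (blockStart (omegaWord f12 0) (b + N) - blockStart (omegaWord f12 0) b + 11)
      (by omega) (by omega) (by omega) (fun j hj => by
        rw [hR.word_eq j (by omega)]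
        congr 1
        omega)
    omega

end UndirectedWords

/-! ### The lower bound for the threshold, and the conclusion -/

namespace UndirectedWords

/-! ### The undirected repetition threshold -/

/-- Two equal factors, or a factor and its reversal, are far apart in a word that is undirected
`(k-1)/(k-2)`-free. -/
theorem UndirectedFree.not_repetition {k : ℕ} (hk : 4 ≤ k) {w : ℕ → Fin k}
    (h : UndirectedFree (((k : ℝ) - 1) / ((k : ℝ) - 2)) w) {i p l : ℕ} (hl : 0 < l)
    (hlp : l ≤ p) (hp : p ≤ (k - 2) * l) :
    ¬ SameUpToReversal (factor w i l) (factor w (i + p) l) := by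
  intro hs
  refine h (factor w i (p + l)) ⟨i, p + l, rfl⟩ (((p + l : ℕ) : ℚ) / (p : ℕ)) ?_
    ⟨factor w i l, factor w (i + l) (p - l), factor w (i + p) l, ?_, hs, ?_, ?_⟩
  · have hp0 : (0 : ℝ) < p := by exact_mod_cast hl.trans_le hlp
    have hk' : (4 : ℝ) ≤ k := by exact_mod_cast hk
    have hp' : (p : ℝ) ≤ ((k : ℝ) - 2) * l := by
      have : (p : ℝ) ≤ (((k - 2) * l : ℕ) : ℝ) := by exact_mod_cast hp
      rwa [Nat.cast_mul, Nat.cast_sub (by omega), Nat.cast_ofNat] at this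
    push_cast
    rw [div_le_div_iff₀ (by linarith) hp0]
    nlinarith
  · intro e
    have := length_factor w i l
    rw [e] at this
    simp at this
    omega
  · rw [← factor_add, show l + (p - l) = p by omega, ← factor_add]
  · simp only [List.length_append, length_factor]
    rw [show l + (p - l) = p by omega]

/-- Any k - 1 consecutive letters are distinct, so at most one letter is missing from them. A
recurrence after k - 1 places would force a reversed pair of letters nearby; without it the word has
period k from its second letter on, which repeats a pair. -/
theorem not_undirectedFree {k : ℕ} (hk : 4 ≤ k) (w : ℕ → Fin k) :
    ¬ UndirectedFree (((k : ℝ) - 1) / ((k : ℝ) - 2)) w := by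
  intro h
  have one : ∀ i p, 0 < p → p ≤ k - 2 → w i ≠ w (i + p) := by
    intro i p h0 hp e
    refine h.not_repetition hk (i := i) (p := p) (l := 1) one_pos h0 (by omega) (Or.inl ?_)
    rw [factor_one, factor_one, e]
  have f2 : ∀ i, factor w i 2 = [w i, w (i + 1)] := fun i => by
    simp [factor, List.range_succ]
  -- Distances up to `k` are allowed because `k ≤ 2 * (k - 2)` for `k ≥ 4`.
  have two : ∀ i p, 2 ≤ p → p ≤ k → w (i + p) = w i → w (i + p + 1) ≠ w (i + 1) := by
    intro i p h0 hp e e'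
    refine h.not_repetition hk (i := i) (p := p) (l := 2) two_pos h0 (by omega) (Or.inl ?_)
    rw [f2, f2, e, e']
  have two' : ∀ i p, 2 ≤ p → p ≤ k → w (i + p) = w (i + 1) → w (i + p + 1) ≠ w i := by
    intro i p h0 hp e e'
    refine h.not_repetition hk (i := i) (p := p) (l := 2) two_pos h0 (by omega) (Or.inr ?_)
    rw [f2, f2, e, e']
    rfl
  have inj : ∀ i, Function.Injective fun j : Fin (k - 1) => w (i + j) := by
    intro i x y e
    by_contra hne
    rcases lt_or_gt_of_ne (fun e => hne (Fin.ext e) : (x : ℕ) ≠ y) with hxy | hxy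
    · refine one (i + x) (y - x) (by omega) (by omega) ?_
      rw [show i + (x : ℕ) + (y - x) = i + y by omega]
      exact e
    · refine one (i + y) (x - y) (by omega) (by omega) ?_
      rw [show i + (y : ℕ) + (x - y) = i + x by omega]
      exact e.symm
  have missing : ∀ i a b, (∀ j < k - 1, w (i + j) ≠ a) → (∀ j < k - 1, w (i + j) ≠ b) → a = b := by
    intro i a b ha hb
    by_contra hab
    have h1 : (Finset.univ.image fun j : Fin (k - 1) => w (i + j)).card = k - 1 := by
      rw [Finset.card_image_of_injective _ (inj i), Finset.card_univ, Fintype.card_fin]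
    have h2 : Finset.univ.image (fun j : Fin (k - 1) => w (i + j)) ⊆
        (Finset.univ.erase a).erase b := by
      intro c hc
      obtain ⟨j, -, rfl⟩ := Finset.mem_image.1 hc
      simp only [Finset.mem_erase, Finset.mem_univ, and_true]
      exact ⟨hb j j.isLt, ha j j.isLt⟩
    have h3 := Finset.card_le_card h2
    rw [h1, Finset.card_erase_of_mem (by simp [Ne.symm hab]), Finset.card_erase_of_mem (by simp),
      Finset.card_univ, Fintype.card_fin] at h3
    omega
  -- a letter that recurs after `k - 1` places or else after `k` places
  have recur : ∀ i, w (i + (k - 1)) ≠ w i → w (i + k) ≠ w (i + 1) → w (i + k) = w i := by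
    intro i h1 h2
    apply missing (i + 1)
    · intro j hj e
      rcases Nat.eq_zero_or_pos j with rfl | hj0
      · exact h2 (by rw [← e, add_zero])
      · refine one (i + 1 + j) (k - 1 - j) (by omega) (by omega) ?_
        rw [e]
        congr 1
        omega
    · intro j hj e
      by_cases hjk : j = k - 2
      · apply h1
        rw [← e]
        congr 1
        omega
      · refine one i (j + 1) (by omega) (by omega) ?_
        rw [← e]
        congr 1
        omega
  have never : ∀ i, 0 < i → w (i + (k - 1)) ≠ w i := by
    intro i hi e
    obtain ⟨i, rfl⟩ := Nat.exists_eq_add_of_lt hi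
    rw [zero_add] at e
    -- the letter before position `i + 1` recurs after `k + 1` places
    have h1 : w (i + (k - 1)) ≠ w i := by
      intro e'
      refine two i (k - 1) (by omega) (by omega) e' ?_
      rw [← e]
      congr 1
      omega
    have h2 : w (i + 1 + k) ≠ w (i + 2) := by
      intro e'
      refine two (i + 1) (k - 1) (by omega) (by omega) e ?_
      rw [show i + 1 + (k - 1) + 1 = i + 1 + k by omega, e']
    have h3 : w (i + 1 + k) = w i := by
      apply missing (i + 1)
      · intro j hj e'
        rcases Nat.lt_or_ge j 1 with hj0 | hj0
        · obtain rfl : j = 0 := by omega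
          refine one (i + 1 + (k - 1)) 1 (by omega) (by omega) ?_
          rw [e, show i + 1 + (k - 1) + 1 = i + 1 + k by omega, ← e', add_zero]
        · by_cases hj1 : j = 1
          · subst hj1
            exact h2 e'.symm
          · refine one (i + 1 + j) (k - j) (by omega) (by omega) ?_
            rw [e']
            congr 1
            omega
      · intro j hj e'
        by_cases hjk : j = k - 2
        · apply h1
          rw [← e']
          congr 1
          omega
        · refine one i (j + 1) (by omega) (by omega) ?_
          rw [← e']
          congr 1
          omega
    -- The letters at `i + k`, `i + k + 1` reverse those at `i`, `i + 1`; only here are reversed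
    -- factors needed.
    refine two' i k (by omega) le_rfl ?_ ?_
    · rw [← e]
      congr 1
      omega
    · rw [← h3]
      congr 1
      omega
  have period : ∀ i, 0 < i → w (i + k) = w i := by
    intro i hi
    refine recur i (never i hi) fun e => never (i + 1) (by omega) ?_
    rw [← e]
    congr 1
    omega
  refine two 1 k (by omega) le_rfl (period 1 one_pos) ?_
  rw [show 1 + k + 1 = 2 + k by omega]
  exact period 2 two_pos

theorem URT_eq_of_undirectedPlusFree {k : ℕ} (hk : 4 ≤ k) {w : ℕ → Fin k}
    (h : UndirectedPlusFree (((k : ℝ) - 1) / ((k : ℝ) - 2)) w) :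
    URT k = ((((k : ℝ) - 1) / ((k : ℝ) - 2) : ℝ) : EReal) := by
  have hk' : (4 : ℝ) ≤ k := by exact_mod_cast hk
  have h1 : (1 : ℝ) < ((k : ℝ) - 1) / ((k : ℝ) - 2) := by
    rw [lt_div_iff₀ (by linarith)]
    linarith
  have h2 : ((k : ℝ) - 1) / ((k : ℝ) - 2) < 2 := by
    rw [div_lt_iff₀ (by linarith)]
    linarith
  apply le_antisymm
  · apply le_of_forall_gt_imp_ge_of_dense
    intro c hc
    obtain ⟨x, hx1, hx2⟩ := EReal.lt_iff_exists_real_btwn.1 hc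
    -- The minimum with 2 keeps the exponent within the range over which the infimum is taken.
    have hx : ((k : ℝ) - 1) / ((k : ℝ) - 2) < min x 2 :=
      lt_min (by exact_mod_cast hx1) h2
    have hw : UndirectedFree (min x 2) w := fun v hv r hr => h v hv r (hx.trans_le hr)
    have hle : URT k ≤ ((min x 2 : ℝ) : EReal) :=
      sInf_le (Set.mem_image_of_mem _ ⟨h1.trans hx, min_le_right _ _, w, hw⟩)
    exact hle.trans ((EReal.coe_le_coe_iff.2 (min_le_left _ _)).trans hx2.le)
  · apply le_sInf
    rintro _ ⟨α, ⟨-, -, w', hw'⟩, rfl⟩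
    rw [EReal.coe_le_coe_iff]
    by_contra hlt
    exact not_undirectedFree hk w' fun v hv r hr => hw' v hv r ((not_le.1 hlt).le.trans hr)

theorem conclusion_of_undirectedPlusFree {n : ℕ} {f : Fin 2 → List (Fin 2)}
    (h : UndirectedPlusFree ((((n + 4 : ℕ) : ℝ) - 1) / (((n + 4 : ℕ) : ℝ) - 2))
      (word n (omegaWord f 0))) :
    (∃! w : ℕ → Fin (n + 4), HasStandardPrefix w ∧ IsEncoding w (mapWord g (omegaWord f 0))) ∧
    (∀ w : ℕ → Fin (n + 4), HasStandardPrefix w → IsEncoding w (mapWord g (omegaWord f 0)) →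
      UndirectedPlusFree ((((n + 4 : ℕ) : ℝ) - 1) / (((n + 4 : ℕ) : ℝ) - 2)) w) ∧
    URT (n + 4) = (((((n + 4 : ℕ) : ℝ) - 1) / (((n + 4 : ℕ) : ℝ) - 2) : ℝ) : EReal) := by
  refine ⟨⟨word n (omegaWord f 0), ⟨decode_standard n _,
    isEncoding_decode (isEncodable_word n _)⟩, fun w hw => hw.2.eq_decode hw.1⟩,
    fun w hw hw' => ?_, URT_eq_of_undirectedPlusFree (by omega) h⟩
  rw [hw'.eq_decode hw]
  exact h

end UndirectedWords

theorem theorem5 (k : ℕ) (f : Fin 2 → List (Fin 2))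
    (hk : (k = 4 ∧ f = UndirectedWords.f4) ∨ (k = 8 ∧ f = UndirectedWords.f8) ∨
      (k = 12 ∧ f = UndirectedWords.f12)) :
    (∃! w : ℕ → Fin k, UndirectedWords.HasStandardPrefix w ∧
      UndirectedWords.IsEncoding w
        (UndirectedWords.mapWord UndirectedWords.g (UndirectedWords.omegaWord f 0))) ∧
    (∀ w : ℕ → Fin k, UndirectedWords.HasStandardPrefix w →
      UndirectedWords.IsEncoding w
        (UndirectedWords.mapWord UndirectedWords.g (UndirectedWords.omegaWord f 0)) →
      UndirectedWords.UndirectedPlusFree (((k : ℝ) - 1) / ((k : ℝ) - 2)) w) ∧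
    UndirectedWords.URT k = ((((k : ℝ) - 1) / ((k : ℝ) - 2) : ℝ) : EReal) := by
  rcases hk with ⟨rfl, rfl⟩ | ⟨rfl, rfl⟩ | ⟨rfl, rfl⟩
  · exact UndirectedWords.conclusion_of_undirectedPlusFree UndirectedWords.undirectedPlusFree_f4
  · exact UndirectedWords.conclusion_of_undirectedPlusFree UndirectedWords.undirectedPlusFree_f8
  · exact UndirectedWords.conclusion_of_undirectedPlusFree UndirectedWords.undirectedPlusFree_f12
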